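/- Let $\alpha_0,\alpha_1,\alpha_2,\alpha_3\in\mathbb{C}$ with $\alpha_0+\alpha_1+2\alpha_2+\alpha_3=\tfrac12$, put $A=\alpha_0+\alpha_1+\alpha_3$, and consider the system ($'=d/dt$) $$\begin{aligned} tq_1'&=2q_1^2p_1-q_1^2+Aq_1-t+4tp_2+2q_1q_2p_2, & tp_1'&=-2q_1p_1^2+2q_1p_1-Ap_1+\alpha_0-2p_1q_2p_2,\\ tq_2'&=2q_2^2p_2-q_2^2+Aq_2-t+4tp_1+2q_1p_1q_2, & tp_2'&=-2q_2p_2^2+2q_2p_2-Ap_2+\alpha_1-2q_1p_1p_2 \end{aligned}$$ with Hamiltonian $$H=q_1^2p_1^2-q_1^2p_1+Aq_1p_1-\alpha_0q_1-tp_1+q_2^2p_2^2-q_2^2p_2+Aq_2p_2-\alpha_1q_2-tp_2+4tp_1p_2+2q_1p_1q_2p_2 .$$ (1) Let $c\in\mathbb{C}$, $c\neq0$, and let $(q_1,p_1,q_2,p_2)$ be a solution that is meromorphic at $t=c$. Then the residue at $t=c$ of $H$ along the solution is $nc/4$ for some $n\in\mathbb{Z}$. (2) Let $(q_1,p_1,q_2,p_2)$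 be a rational solution, and let $h_{\infty,0}$ and $h_{0,0}$ be the constant terms of the Laurent expansions of $H$ along the solution at $t=\infty$ and at $t=0$. Then $$4(h_{\infty,0}-h_{0,0})\in\mathbb{Z}.$$ Here $$h_{\infty,0}=\tfrac34(\alpha_0+\alpha_1+\alpha_3)^2-\tfrac12(-2\alpha_0+\alpha_3)(-2\alpha_1+\alpha_3)-3(\alpha_0+\alpha_1)\alpha_3,$$ and one of the following holds. (a) $q_1,p_1,q_2,p_2$ are all holomorphic at $t=0$, and their values $a,b,c,d$ there satisfy one of * $a=0$, $-(\alpha_0+\alpha_1+\alpha_3)b+\alpha_0=0$, $c=0$, $-(\alpha_0+\alpha_1+\alpha_3)d+\alpha_1=0$, and $h_{0,0}=0$; * $a=0$, $(-\alpha_0+\alpha_1-\alpha_3)b+\alpha_0=0$, $c=\alpha_0-\alpha_1+\alpha_3$, $(-\alpha_0+\alpha_1-\alpha_3)d-\alpha_1=0$, and $h_{0,0}=-\alpha_1(\alpha_0+\alpha_3)$; * $a=-\alpha_0+\alpha_1+\alpha_3$, $(\alpha_0-\alpha_1-\alpha_3)b-\alpha_0=0$, $c=0$, $(\alpha_0-\alpha_1-\alpha_3)d+\alpha_1=0$,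 and $h_{0,0}=-\alpha_0(\alpha_1+\alpha_3)$; * $a=-\alpha_0-\alpha_1+\alpha_3$, $(\alpha_0+\alpha_1-\alpha_3)b-\alpha_0=0$, $c=-\alpha_0-\alpha_1+\alpha_3$, $(\alpha_0+\alpha_1-\alpha_3)d-\alpha_1=0$, and $h_{0,0}=-\alpha_3(\alpha_0+\alpha_1)$. (b) $p_1$ has a pole at $t=0$, $q_1,q_2,p_2$ are holomorphic there, and $h_{0,0}=-\tfrac14(\alpha_0+\alpha_1+\alpha_3)^2+\alpha_1^2+\tfrac3{16}$. (c) $p_2$ has a pole at $t=0$, $q_1,p_1,q_2$ are holomorphic there, and $h_{0,0}=-\tfrac14(\alpha_0+\alpha_1+\alpha_3)^2+\alpha_0^2+\tfrac3{16}$. -/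

import Mathlib

open Filter Topology

namespace SasanoA52

/-- The Laurent series `a = ∑ aₖ Xᵏ` (finitely many negative exponents) is the Laurent expansion
of `f` at the point `c`: it converges to `f z` at `z - c` for all `z ≠ c` close to `c`. -/
def HasLaurentExpansionAt (f : ℂ → ℂ) (c : ℂ) (a : LaurentSeries ℂ) : Prop :=
  ∀ᶠ z in 𝓝[≠] c, HasSum (fun k : ℤ => a.coeff k * (z - c) ^ k) (f z)

/-- The Laurent expansion of `f` at infinity, in the local coordinate `w = 1 / t`: the
coefficient of `tᵏ` is `a.coeff (-k)`. -/
def HasLaurentExpansionAtInfinity (f : ℂ → ℂ) (a : LaurentSeries ℂ) : Prop :=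
  HasLaurentExpansionAt (fun w => f w⁻¹) 0 a

/-- The four differential equations of the system of type `A₅⁽²⁾` with parameters
`α₀, α₁, α₂, α₃` at the point `t`
(`α₂` enters only through the normalisation `α₀ + α₁ + 2 α₂ + α₃ = 1 / 2`). -/
def SystemAt (α₀ α₁ α₃ : ℂ) (q₁ p₁ q₂ p₂ : ℂ → ℂ) (t : ℂ) : Prop :=
  t * deriv q₁ t = 2 * q₁ t ^ 2 * p₁ t - q₁ t ^ 2 + (α₀ + α₁ + α₃) * q₁ t - t + 4 * t * p₂ t
      + 2 * q₁ t * q₂ t * p₂ t ∧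
  t * deriv p₁ t = -2 * q₁ t * p₁ t ^ 2 + 2 * q₁ t * p₁ t - (α₀ + α₁ + α₃) * p₁ t + α₀
      - 2 * p₁ t * q₂ t * p₂ t ∧
  t * deriv q₂ t = 2 * q₂ t ^ 2 * p₂ t - q₂ t ^ 2 + (α₀ + α₁ + α₃) * q₂ t - t + 4 * t * p₁ t
      + 2 * q₁ t * p₁ t * q₂ t ∧
  t * deriv p₂ t = -2 * q₂ t * p₂ t ^ 2 + 2 * q₂ t * p₂ t - (α₀ + α₁ + α₃) * p₂ t + α₁
      - 2 * q₁ t * p₁ t * p₂ t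

/-- A meromorphic solution at the point `c`. -/
def IsMeromorphicSolutionAt (α₀ α₁ α₃ : ℂ) (q₁ p₁ q₂ p₂ : ℂ → ℂ) (c : ℂ) : Prop :=
  MeromorphicAt q₁ c ∧ MeromorphicAt p₁ c ∧ MeromorphicAt q₂ c ∧ MeromorphicAt p₂ c ∧
  ∀ᶠ t in 𝓝[≠] c, SystemAt α₀ α₁ α₃ q₁ p₁ q₂ p₂ t

/-- The function `t ↦ r(t)` on `ℂ` given by a rational function `r` (meaningful off its poles). -/
noncomputable def toFun (r : RatFunc ℂ) (t : ℂ) : ℂ := r.eval (RingHom.id ℂ) t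

/-- A rational solution: the equations hold off finitely many points, hence off the poles. -/
def IsRationalSolution (α₀ α₁ α₃ : ℂ) (q₁ p₁ q₂ p₂ : RatFunc ℂ) : Prop :=
  ∀ᶠ t in cofinite, SystemAt α₀ α₁ α₃ (toFun q₁) (toFun p₁) (toFun q₂) (toFun p₂) t

/-- The Hamiltonian, evaluated along `(q₁, p₁, q₂, p₂)`. -/
def hamiltonian (α₀ α₁ α₃ : ℂ) (q₁ p₁ q₂ p₂ : ℂ → ℂ) (t : ℂ) : ℂ :=
  q₁ t ^ 2 * p₁ t ^ 2 - q₁ t ^ 2 * p₁ t + (α₀ + α₁ + α₃) * q₁ t * p₁ t - α₀ * q₁ t - t * p₁ t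
    + q₂ t ^ 2 * p₂ t ^ 2 - q₂ t ^ 2 * p₂ t + (α₀ + α₁ + α₃) * q₂ t * p₂ t - α₁ * q₂ t - t * p₂ t
    + 4 * t * p₁ t * p₂ t + 2 * q₁ t * p₁ t * q₂ t * p₂ t

/-- `r` is holomorphic at `t = 0` (numerator and denominator of a `RatFunc` are coprime). -/
def HolomorphicAtZero (r : RatFunc ℂ) : Prop := r.denom.eval 0 ≠ 0

/-- The explicit constant term at infinity. -/
noncomputable def hInfinity (α₀ α₁ α₃ : ℂ) : ℂ :=
  3 / 4 * (α₀ + α₁ + α₃) ^ 2 - 1 / 2 * (-2 * α₀ + α₃) * (-2 * α₁ + α₃) - 3 * (α₀ + α₁) * α₃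

/-- The explicit values `h` of the constant term at zero, with the cases in which they occur, where
`a, b, c, d` are the values at `t = 0` of `q₁, p₁, q₂, p₂` where these are holomorphic. -/
def IsHZero (α₀ α₁ α₃ : ℂ) (q₁ p₁ q₂ p₂ : RatFunc ℂ) (h : ℂ) : Prop :=
  let a := toFun q₁ 0
  let b := toFun p₁ 0
  let c := toFun q₂ 0
  let d := toFun p₂ 0
  (HolomorphicAtZero q₁ ∧ HolomorphicAtZero p₁ ∧ HolomorphicAtZero q₂ ∧ HolomorphicAtZero p₂ ∧
    ((a = 0 ∧ -(α₀ + α₁ + α₃) * b + α₀ = 0 ∧ c = 0 ∧ -(α₀ + α₁ + α₃) * d + α₁ = 0 ∧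
        h = 0) ∨
     (a = 0 ∧ (-α₀ + α₁ - α₃) * b + α₀ = 0 ∧ c = α₀ - α₁ + α₃ ∧
        (-α₀ + α₁ - α₃) * d - α₁ = 0 ∧ h = -α₁ * (α₀ + α₃)) ∨
     (a = -α₀ + α₁ + α₃ ∧ (α₀ - α₁ - α₃) * b - α₀ = 0 ∧ c = 0 ∧
        (α₀ - α₁ - α₃) * d + α₁ = 0 ∧ h = -α₀ * (α₁ + α₃)) ∨
     (a = -α₀ - α₁ + α₃ ∧ (α₀ + α₁ - α₃) * b - α₀ = 0 ∧ c = -α₀ - α₁ + α₃ ∧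
        (α₀ + α₁ - α₃) * d - α₁ = 0 ∧ h = -α₃ * (α₀ + α₁)))) ∨
  (HolomorphicAtZero q₁ ∧ ¬ HolomorphicAtZero p₁ ∧ HolomorphicAtZero q₂ ∧ HolomorphicAtZero p₂ ∧
    h = -(1 / 4) * (α₀ + α₁ + α₃) ^ 2 + α₁ ^ 2 + 3 / 16) ∨
  (HolomorphicAtZero q₁ ∧ HolomorphicAtZero p₁ ∧ HolomorphicAtZero q₂ ∧ ¬ HolomorphicAtZero p₂ ∧
    h = -(1 / 4) * (α₀ + α₁ + α₃) ^ 2 + α₀ ^ 2 + 3 / 16)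

end SasanoA52

/-! The system is Hamiltonian for the derivation `t d/dt`, so along a solution `H' = 4 p₁ p₂ - p₁ -
p₂`, and the residue of `H` is minus the coefficient of order -2 of this expression. What has to be
found are pole orders and leading coefficients of Laurent series satisfying the system formally
(`FormalSolution`).

Put `u = q₁ p₁ + q₂ p₂`. Each of `p₁`, `p₂` and `p₁ + p₂ - 1` satisfies a linear first order
equation, with coefficient `2 (u - q₁) + A`, `2 (u - q₂) + A` and `2 u + A` respectively. A pole of
the unknown therefore controls the coefficient: at `c ≠ 0` the coefficient has at most a simple
pole, with residue `c` times the pole order (`simple_pole_of_linear`); at the origin and at infinity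
it is regular (`regular_of_linear`). The quadratic equations for `q₁` and `q₂` then bound `p₂` and
`p₁`. At `c ≠ 0` only a few balances survive, and the coefficient of order -2 of `H'` is `0`,
`-c/4`, `-c/2` or `-c` (`energy`). At the origin at most one of `p₁`, `p₂` has a pole (`pole_zero`,
`regular_zero`); at infinity everything is regular and both take the value `1/4`
(`energy_infinity`). This gives the constant terms.

Along a rational solution `H` has at most simple poles off the origin, so it is a Laurent polynomial
plus a finite sum of terms `(n_c c / 4) / (t - c)`. A Laurent polynomial has the same constant term
at `0` and at infinity, while such a fraction contributes `-n_c / 4` at `0` and nothing at infinity.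
Hence four times the difference is the sum of the `n_c` (`exists_int_of_residues`). -/

namespace SasanoA52

/-! ### Coefficients of Laurent series -/

/-- All coefficients of `a` of index below `n` vanish. -/
def VanishesBelow (n : ℤ) (a : LaurentSeries ℂ) : Prop := ∀ i < n, a.coeff i = 0

namespace VanishesBelow

variable {m n : ℤ} {a b : LaurentSeries ℂ}

lemma mono (h : VanishesBelow n a) (hmn : m ≤ n) : VanishesBelow m a :=
  fun i hi => h i (by lia)

lemma add (ha : VanishesBelow n a) (hb : VanishesBelow n b) : VanishesBelow n (a + b) :=
  fun i hi => by simp [ha i hi, hb i hi]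

lemma sub (ha : VanishesBelow n a) (hb : VanishesBelow n b) : VanishesBelow n (a - b) :=
  fun i hi => by simp [ha i hi, hb i hi]

lemma succ (ha : VanishesBelow n a) (h : a.coeff n = 0) : VanishesBelow (n + 1) a := by
  intro i hi
  rcases eq_or_ne i n with rfl | hn
  · exact h
  · exact ha i (by lia)

lemma mul (ha : VanishesBelow m a) (hb : VanishesBelow n b) : VanishesBelow (m + n) (a * b) := by
  intro i hi
  rw [HahnSeries.coeff_mul]
  refine Finset.sum_eq_zero fun x hx => ?_
  rw [Finset.mem_antidiagonal] at hx
  rcases lt_or_ge x.1 m with h | h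
  · rw [ha _ h, zero_mul]
  · rw [hb x.2 (by lia), mul_zero]

/-- The Hahn product sums over pairs in the supports. Indexing by the offset from `m` gives a fixed
range in which zero coefficients are harmless, so lower bounds on the orders suffice. -/
lemma coeff_mul (ha : VanishesBelow m a) (hb : VanishesBelow n b) (k : ℕ) :
    (a * b).coeff (m + n + k) =
      ∑ i ∈ Finset.range (k + 1), a.coeff (m + i) * b.coeff (n + (k - i)) := by
  rw [HahnSeries.coeff_mul]
  have key : ∀ x : ℤ × ℤ, x.1 + x.2 = m + n + k → a.coeff x.1 ≠ 0 → b.coeff x.2 ≠ 0 →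
      m ≤ x.1 ∧ n ≤ x.2 := by
    intro x _ h1 h2
    constructor <;> by_contra! h
    · exact h1 (ha _ h)
    · exact h2 (hb _ h)
  refine Finset.sum_bij_ne_zero (fun x _ _ => (x.1 - m).toNat) ?_ ?_ ?_ ?_
  · intro x hx _
    rw [Finset.mem_antidiagonal] at hx
    have := key x hx.2.2 hx.1 hx.2.1
    rw [Finset.mem_range]; lia
  · intro x hx _ y hy _ h
    rw [Finset.mem_antidiagonal] at hx hy
    have h1 := key x hx.2.2 hx.1 hx.2.1
    have h2 := key y hy.2.2 hy.1 hy.2.1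
    ext <;> lia
  · intro i hi h
    rw [Finset.mem_range] at hi
    refine ⟨(m + i, n + (k - i)), ?_, h, by simp⟩
    rw [Finset.mem_antidiagonal]
    exact ⟨left_ne_zero_of_mul h, right_ne_zero_of_mul h, by simp only; ring⟩
  · intro x hx _
    rw [Finset.mem_antidiagonal] at hx
    have := key x hx.2.2 hx.1 hx.2.1
    congr 2 <;> lia

lemma coeff_mul_lead (ha : VanishesBelow m a) (hb : VanishesBelow n b) {j : ℤ} (hj : j = m + n) :
    (a * b).coeff j = a.coeff m * b.coeff n := by
  simpa [hj] using ha.coeff_mul hb 0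

lemma coeff_mul_next (ha : VanishesBelow m a) (hb : VanishesBelow n b) {j : ℤ}
    (hj : j = m + n + 1) :
    (a * b).coeff j = a.coeff m * b.coeff (n + 1) + a.coeff (m + 1) * b.coeff n := by
  simpa [hj, Finset.sum_range_succ] using ha.coeff_mul hb 1

end VanishesBelow

lemma exists_leading {a : LaurentSeries ℂ} (ha : a ≠ 0) :
    ∃ n : ℤ, VanishesBelow n a ∧ a.coeff n ≠ 0 :=
  ⟨a.order, fun _ hi => HahnSeries.coeff_eq_zero_of_lt_order hi,
    fun h => ha (HahnSeries.coeff_order_eq_zero.mp h)⟩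

lemma exists_leading_of_not_vanishesBelow {a : LaurentSeries ℂ} {m : ℤ}
    (ha : ¬ VanishesBelow m a) : ∃ n < m, VanishesBelow n a ∧ a.coeff n ≠ 0 := by
  obtain ⟨n, hn, h0⟩ := exists_leading (a := a) (by rintro rfl; exact ha fun i _ => by simp)
  exact ⟨n, by by_contra! h; exact ha (hn.mono h), hn, h0⟩

/-- Cancelling a factor of exact order `m`. -/
lemma VanishesBelow.of_mul {m n : ℤ} {a b : LaurentSeries ℂ} (hab : VanishesBelow n (a * b))
    (ha : VanishesBelow m a) (h0 : a.coeff m ≠ 0) : VanishesBelow (n - m) b := by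
  by_contra hb
  obtain ⟨k, hk, hk1, hk2⟩ := exists_leading_of_not_vanishesBelow hb
  have := ha.coeff_mul_lead hk1 rfl
  rw [hab _ (by lia)] at this
  exact mul_ne_zero h0 hk2 this.symm

@[simp] lemma coeff_C_mul (r : ℂ) (a : LaurentSeries ℂ) (n : ℤ) :
    (HahnSeries.C r * a).coeff n = r * a.coeff n := by
  rw [HahnSeries.C_mul_eq_smul]; simp

@[simp] lemma coeff_two_mul (a : LaurentSeries ℂ) (n : ℤ) :
    (2 * a).coeff n = 2 * a.coeff n := by
  rw [← coeff_C_mul, map_ofNat]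

@[simp] lemma coeff_four_mul (a : LaurentSeries ℂ) (n : ℤ) :
    (4 * a).coeff n = 4 * a.coeff n := by
  rw [← coeff_C_mul, map_ofNat]

lemma coeff_C (r : ℂ) (n : ℤ) : 
    (HahnSeries.C r : LaurentSeries ℂ).coeff n = if n = 0 then r else 0 := by
  
  rw [HahnSeries.C_apply, HahnSeries.coeff_single]; congr

lemma VanishesBelow.four_mul {n : ℤ} {a : LaurentSeries ℂ} (ha : VanishesBelow n a) :
    VanishesBelow n (4 * a) := fun i hi => by simp [ha i hi]

lemma vanishesBelow_C (r : ℂ) : VanishesBelow 0 (HahnSeries.C r) := fun i hi => by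
  rw [coeff_C, if_neg hi.ne]

lemma vanishesBelow_one : VanishesBelow 0 1 := by
  simpa using vanishesBelow_C 1

/-- The formal derivative. -/
noncomputable def dX (a : LaurentSeries ℂ) : LaurentSeries ℂ := LaurentSeries.derivative ℂ a

@[simp] lemma coeff_dX (a : LaurentSeries ℂ) (n : ℤ) :
    (dX a).coeff n = (n + 1) * a.coeff (n + 1) := by
  simp [dX]

lemma dX_add (a b : LaurentSeries ℂ) : dX (a + b) = dX a + dX b := map_add _ _ _

lemma dX_sub (a b : LaurentSeries ℂ) : dX (a - b) = dX a - dX b := map_sub _ _ _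

lemma dX_one : dX 1 = 0 := by
  ext n
  rw [coeff_dX, HahnSeries.coeff_one]
  split_ifs with h
  · rw [HahnSeries.coeff_zero, ← Int.cast_one, ← Int.cast_add, h]; simp
  · simp

lemma VanishesBelow.dX {n : ℤ} {a : LaurentSeries ℂ} (ha : VanishesBelow n a) :
    VanishesBelow (n - 1) (dX a) := fun i hi => by rw [coeff_dX, ha _ (by lia), mul_zero]

/-! ### Laurent expansions of meromorphic functions -/

/-- The Taylor series of `g` at `c`. -/
noncomputable def taylor (g : ℂ → ℂ) (c : ℂ) : PowerSeries ℂ :=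
  PowerSeries.mk fun n => iteratedDeriv n g c / n.factorial

section Taylor

variable {f g : ℂ → ℂ} {c : ℂ}

lemma taylor_congr (h : f =ᶠ[𝓝 c] g) : taylor f c = taylor g c := by
  ext n
  simp [taylor, h.iteratedDeriv_eq n]

lemma taylor_add (hf : AnalyticAt ℂ f c) (hg : AnalyticAt ℂ g c) :
    taylor (fun z => f z + g z) c = taylor f c + taylor g c := by
  ext n
  simp [taylor, iteratedDeriv_fun_add hf.contDiffAt hg.contDiffAt, add_div]

lemma taylor_mul (hf : AnalyticAt ℂ f c) (hg : AnalyticAt ℂ g c) :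
    taylor (fun z => f z * g z) c = taylor f c * taylor g c := by
  ext n
  simp only [taylor, PowerSeries.coeff_mk, PowerSeries.coeff_mul,
    iteratedDeriv_fun_mul hf.contDiffAt hg.contDiffAt,
    Finset.Nat.sum_antidiagonal_eq_sum_range_succ_mk, Finset.sum_div]
  refine Finset.sum_congr rfl fun i hi => ?_
  rw [Finset.mem_range] at hi
  rw [Nat.cast_choose _ (by lia)]
  field_simp [Nat.factorial_ne_zero]

lemma taylor_const (r : ℂ) : taylor (fun _ => r) c = PowerSeries.C r := by
  ext n
  rw [PowerSeries.coeff_C]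
  simp only [taylor, PowerSeries.coeff_mk, iteratedDeriv_const]
  split_ifs with h <;> simp [h]

lemma coeff_taylor_deriv (n : ℕ) :
    PowerSeries.coeff n (taylor (deriv f) c) = (n + 1) * PowerSeries.coeff (n + 1) (taylor f c) := by
  simp only [taylor, PowerSeries.coeff_mk, ← iteratedDeriv_succ', Nat.factorial_succ]
  have : (n.factorial : ℂ) ≠ 0 := by exact_mod_cast n.factorial_ne_zero
  have : (n + 1 : ℂ) ≠ 0 := by exact_mod_cast n.succ_ne_zero
  push_cast
  field_simp

lemma taylor_sub_center : taylor (fun z => z - c) c = PowerSeries.X := by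
  ext n
  rw [PowerSeries.coeff_X]
  rcases n with _ | n
  · simp [taylor]
  · have : deriv (fun z : ℂ => z - c) = fun _ => 1 := by
      ext z; simp
    simp only [taylor, PowerSeries.coeff_mk, iteratedDeriv_succ', this, iteratedDeriv_const]
    rcases n with _ | n <;> simp

lemma taylor_pow (hf : AnalyticAt ℂ f c) (n : ℕ) :
    taylor (fun z => f z ^ n) c = taylor f c ^ n := by
  induction n with
  | zero => simpa using taylor_const 1
  | succ n ih =>
    simp only [pow_succ]
    rw [taylor_mul (f := fun z => f z ^ n) (hf.fun_pow n) hf, ih]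

lemma hasSum_taylor (hg : AnalyticAt ℂ g c) :
    ∀ᶠ z in 𝓝 c, HasSum (fun n : ℕ => PowerSeries.coeff n (taylor g c) * (z - c) ^ n) (g z) := by
  filter_upwards [hasFPowerSeriesAt_iff'.mp hg.hasFPowerSeriesAt] with z hz
  simpa [taylor, mul_comm, FormalMultilinearSeries.coeff_ofScalars] using hz

end Taylor

/-- `a` is the Laurent series at `c` of the function `f`, which is meromorphic there. -/
def Expansion (f : ℂ → ℂ) (c : ℂ) (a : LaurentSeries ℂ) : Prop :=
  ∃ (N : ℕ) (g : ℂ → ℂ), AnalyticAt ℂ g c ∧ (∀ᶠ z in 𝓝[≠] c, (z - c) ^ N * f z = g z) ∧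
    HahnSeries.single (N : ℤ) 1 * a = HahnSeries.ofPowerSeries ℤ ℂ (taylor g c)

lemma exists_expansion {f : ℂ → ℂ} {c : ℂ} (hf : MeromorphicAt f c) : ∃ a, Expansion f c a := by
  obtain ⟨N, hN⟩ := hf
  refine ⟨HahnSeries.single (-N : ℤ) 1 * HahnSeries.ofPowerSeries ℤ ℂ
    (taylor (fun z => (z - c) ^ N • f z) c), N, _, hN, .of_forall fun z => rfl, ?_⟩
  rw [← mul_assoc, HahnSeries.single_mul_single]
  simp

lemma coeff_ofPowerSeries_neg (p : PowerSeries ℂ) {n : ℤ} (hn : n < 0) :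
    (HahnSeries.ofPowerSeries ℤ ℂ p).coeff n = 0 := by
  rw [HahnSeries.ofPowerSeries_apply, HahnSeries.embDomain_of_notMem_range]
  rintro ⟨k, hk⟩
  simp at hk
  lia

lemma vanishesBelow_ofPowerSeries (p : PowerSeries ℂ) :
    VanishesBelow 0 (HahnSeries.ofPowerSeries ℤ ℂ p) := fun _ hi => coeff_ofPowerSeries_neg p hi

lemma single_mul_ofPowerSeries_taylor_sub (N : ℕ) (c : ℂ) :
    HahnSeries.single (N : ℤ) (1 : ℂ) =
      HahnSeries.ofPowerSeries ℤ ℂ (taylor (fun z => (z - c) ^ N) c) := by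
  rw [taylor_pow (by fun_prop), taylor_sub_center, map_pow, HahnSeries.ofPowerSeries_X,
    HahnSeries.single_pow]
  simp

namespace Expansion

variable {f g : ℂ → ℂ} {c : ℂ} {a b : LaurentSeries ℂ}

lemma hasLaurentExpansionAt (h : Expansion f c a) : HasLaurentExpansionAt f c a := by
  obtain ⟨N, g, hg, hfg, ha⟩ := h
  filter_upwards [hfg, (hasSum_taylor hg).filter_mono nhdsWithin_le_nhds, self_mem_nhdsWithin]
    with z hz hs hzc
  have hzc : z - c ≠ 0 := sub_ne_zero.mpr hzc
  have hcoeff : ∀ n : ℤ, a.coeff n = (HahnSeries.ofPowerSeries ℤ ℂ (taylor g c)).coeff (n + N) := by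
    intro n
    rw [← ha, HahnSeries.coeff_single_mul_add, one_mul]
  have hinj : Function.Injective (fun n : ℕ => (n : ℤ) - N) := fun m n h => by simpa using h
  have h0 : ∀ k ∉ Set.range (fun n : ℕ => (n : ℤ) - N), a.coeff k * (z - c) ^ k = 0 := by
    intro k hk
    rw [hcoeff, coeff_ofPowerSeries_neg, zero_mul]
    by_contra! h
    exact hk ⟨(k + N).toNat, by simp; lia⟩
  rw [← hinj.hasSum_iff h0]
  have := hs.mul_left ((z - c) ^ (-N : ℤ))
  rw [← hz, zpow_neg, zpow_natCast, inv_mul_cancel_left₀ (pow_ne_zero _ hzc)] at this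
  refine this.congr_fun fun n => ?_
  simp only [Function.comp, hcoeff, sub_add_cancel, LaurentSeries.coeff_coe_powerSeries]
  rw [zpow_sub₀ hzc, zpow_natCast, zpow_natCast]
  ring

lemma congr (h : Expansion f c a) (hfg : f =ᶠ[𝓝[≠] c] g) : Expansion g c a := by
  obtain ⟨N, G, hG, h1, h2⟩ := h
  refine ⟨N, G, hG, ?_, h2⟩
  filter_upwards [h1, hfg] with z hz hz'
  rw [← hz', hz]

lemma of_analyticAt (hf : AnalyticAt ℂ f c) :
    Expansion f c (HahnSeries.ofPowerSeries ℤ ℂ (taylor f c)) :=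
  ⟨0, f, hf, by simp, by simp⟩

lemma const (r : ℂ) : Expansion (fun _ => r) c (HahnSeries.C r) := by
  simpa [taylor_const] using of_analyticAt (c := c) (analyticAt_const (v := r))

lemma add (hf : Expansion f c a) (hg : Expansion g c b) :
    Expansion (fun z => f z + g z) c (a + b) := by
  obtain ⟨N, F, hF, hf1, hf2⟩ := hf
  obtain ⟨M, G, hG, hg1, hg2⟩ := hg
  refine ⟨N + M, fun z => (z - c) ^ M * F z + (z - c) ^ N * G z, by fun_prop, ?_, ?_⟩
  · filter_upwards [hf1, hg1] with z h1 h2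
    rw [← h1, ← h2]; ring
  · rw [taylor_add (by fun_prop) (by fun_prop), taylor_mul (by fun_prop) hF,
      taylor_mul (by fun_prop) hG, map_add, map_mul, map_mul,
      ← single_mul_ofPowerSeries_taylor_sub, ← single_mul_ofPowerSeries_taylor_sub, ← hf2, ← hg2]
    have : HahnSeries.single ((N + M : ℕ) : ℤ) (1 : ℂ) =
        HahnSeries.single (N : ℤ) 1 * HahnSeries.single (M : ℤ) 1 := by
      rw [HahnSeries.single_mul_single]; simp
    rw [this]; ring

lemma mul (hf : Expansion f c a) (hg : Expansion g c b) :
    Expansion (fun z => f z * g z) c (a * b) := by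
  obtain ⟨N, F, hF, hf1, hf2⟩ := hf
  obtain ⟨M, G, hG, hg1, hg2⟩ := hg
  refine ⟨N + M, fun z => F z * G z, by fun_prop, ?_, ?_⟩
  · filter_upwards [hf1, hg1] with z h1 h2
    rw [← h1, ← h2]; ring
  · rw [taylor_mul hF hG, map_mul, ← hf2, ← hg2]
    have : HahnSeries.single ((N + M : ℕ) : ℤ) (1 : ℂ) =
        HahnSeries.single (N : ℤ) 1 * HahnSeries.single (M : ℤ) 1 := by
      rw [HahnSeries.single_mul_single]; simp
    rw [this]; ring

lemma neg (hf : Expansion f c a) : Expansion (fun z => -f z) c (-a) := by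
  have h : HahnSeries.C (-1) * a = -a := by ext n; simp
  exact h ▸ ((const (-1)).mul hf).congr (.of_forall fun z => neg_one_mul (f z))

lemma sub (hf : Expansion f c a) (hg : Expansion g c b) :
    Expansion (fun z => f z - g z) c (a - b) := by
  simpa [sub_eq_add_neg] using hf.add hg.neg

lemma pow (hf : Expansion f c a) (n : ℕ) : Expansion (fun z => f z ^ n) c (a ^ n) := by
  induction n with
  | zero => simpa using const 1
  | succ n ih => simpa only [pow_succ] using ih.mul hf

lemma const_mul (hf : Expansion f c a) (r : ℂ) :
    Expansion (fun z => r * f z) c (HahnSeries.C r * a) := (const r).mul hf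

lemma ofNat_mul (hf : Expansion f c a) (k : ℕ) [k.AtLeastTwo] :
    Expansion (fun z => (OfNat.ofNat k : ℂ) * f z) c ((OfNat.ofNat k : LaurentSeries ℂ) * a) := by
  simpa only [map_ofNat] using hf.const_mul (OfNat.ofNat k)

lemma sum {ι : Type*} (s : Finset ι) {F : ι → ℂ → ℂ} {A : ι → LaurentSeries ℂ}
    (h : ∀ i ∈ s, Expansion (F i) c (A i)) :
    Expansion (fun z => ∑ i ∈ s, F i z) c (∑ i ∈ s, A i) := by
  classical
  induction s using Finset.induction_on with
  | empty => simpa using const 0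
  | insert i s hi ih =>
    simp only [Finset.sum_insert hi]
    exact (h i (by simp)).add (ih fun j hj => h j (by simp [hj]))

lemma eventually_differentiableAt (hf : Expansion f c a) :
    ∀ᶠ z in 𝓝[≠] c, DifferentiableAt ℂ f z := by
  obtain ⟨N, F, hF, hf1, -⟩ := hf
  filter_upwards [eventually_eventually_nhdsWithin.mpr hf1, self_mem_nhdsWithin,
    hF.eventually_analyticAt.filter_mono nhdsWithin_le_nhds] with z h1 hz hFz
  rw [Set.mem_compl_singleton_iff] at hz
  rw [isOpen_compl_singleton.nhdsWithin_eq hz] at h1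
  have h2 : (fun y => F y / (y - c) ^ N) =ᶠ[𝓝 z] f := by
    filter_upwards [h1, isOpen_compl_singleton.mem_nhds hz] with y hy hyc
    rw [← hy, mul_div_cancel_left₀ _ (pow_ne_zero _ (sub_ne_zero.mpr hyc))]
  refine DifferentiableAt.congr_of_eventuallyEq ?_ h2.symm
  exact hFz.differentiableAt.div (by fun_prop) (pow_ne_zero _ (sub_ne_zero.mpr hz))

lemma deriv (hf : Expansion f c a) : Expansion (deriv f) c (dX a) := by
  have hdiff := hf.eventually_differentiableAt
  obtain ⟨N, F, hF, hf1, hf2⟩ := hf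
  -- From `f = (z - c)^(-N) F` one gets `(z - c)^(N + 1) f' = (z - c) F' - N F`.
  refine ⟨N + 1, fun z => (z - c) * _root_.deriv F z + -N * F z, ?_, ?_, ?_⟩
  · have := hF.deriv
    fun_prop
  · filter_upwards [eventually_eventually_nhdsWithin.mpr hf1, self_mem_nhdsWithin, hdiff]
      with z h1 hz hfz
    rw [Set.mem_compl_singleton_iff] at hz
    rw [isOpen_compl_singleton.nhdsWithin_eq hz] at h1
    have h2 : HasDerivAt (fun y => (y - c) ^ N * f y)
        (N * (z - c) ^ (N - 1) * f z + (z - c) ^ N * _root_.deriv f z) z := by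
      simpa using (((hasDerivAt_id z).sub_const c).fun_pow N).fun_mul hfz.hasDerivAt
    rw [← EventuallyEq.deriv_eq h1, ← h1.self_of_nhds, h2.deriv]
    -- `N - 1` is truncated; at `N = 0` the term carries the factor `N = 0`.
    rcases N with _ | N
    · simp
    · simp; ring
  · have hd := hF.deriv
    rw [taylor_add (by fun_prop) (by fun_prop), taylor_mul (by fun_prop) hd,
      taylor_mul (by fun_prop) hF, taylor_const, taylor_sub_center]
    have ha : ∀ n : ℤ, a.coeff n = (HahnSeries.ofPowerSeries ℤ ℂ (taylor F c)).coeff (n + N) := by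
      intro n
      rw [← hf2, HahnSeries.coeff_single_mul_add, one_mul]
    ext n
    rw [HahnSeries.coeff_single_mul, one_mul, coeff_dX, ha,
      map_add, map_mul, map_mul, HahnSeries.ofPowerSeries_X, HahnSeries.ofPowerSeries_C,
      HahnSeries.coeff_add, coeff_C_mul, HahnSeries.coeff_single_mul, one_mul]
    rw [show n - ((N + 1 : ℕ) : ℤ) + 1 + N = n by push_cast; ring]
    have key : (HahnSeries.ofPowerSeries ℤ ℂ (taylor (_root_.deriv F) c)).coeff (n - 1) =
        n * (HahnSeries.ofPowerSeries ℤ ℂ (taylor F c)).coeff n := by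
      rcases lt_or_ge (n - 1) 0 with h | h
      · rw [coeff_ofPowerSeries_neg _ h]
        rcases (show n ≤ 0 by lia).eq_or_lt with rfl | h
        · simp
        · rw [coeff_ofPowerSeries_neg _ h, mul_zero]
      · obtain ⟨m, rfl⟩ : ∃ m : ℕ, n = m + 1 := ⟨(n - 1).toNat, by lia⟩
        rw [add_sub_cancel_right, LaurentSeries.coeff_coe_powerSeries, coeff_taylor_deriv]
        rw [← LaurentSeries.coeff_coe_powerSeries]
        push_cast
        rfl
    rw [key]
    push_cast
    ring

/-- Zeros of the analytic numerator are isolated unless it vanishes identically near `c`. -/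
lemma eq_zero (hf : Expansion f c a) (h0 : ∀ᶠ z in 𝓝[≠] c, f z = 0) : a = 0 := by
  obtain ⟨N, F, hF, hf1, hf2⟩ := hf
  have h1 : ∀ᶠ z in 𝓝[≠] c, F z = 0 := by
    filter_upwards [hf1, h0] with z h1 h2
    rw [← h1, h2, mul_zero]
  have h2 : F =ᶠ[𝓝 c] fun _ => 0 := by
    rcases hF.eventually_eq_zero_or_eventually_ne_zero with h | h
    · exact h
    · obtain ⟨z, hz1, hz2⟩ := (h1.and h).exists
      exact absurd hz1 hz2
  rw [taylor_congr h2, taylor_const, map_zero, map_zero] at hf2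
  rcases mul_eq_zero.mp hf2 with h | h
  · exact absurd h (by simp)
  · exact h

/-- This transfers identities between functions, such as the differential equations, to their
series. -/
lemma unique (hf : Expansion f c a) (hg : Expansion g c b) (hfg : f =ᶠ[𝓝[≠] c] g) : a = b := by
  rw [← sub_eq_zero]
  refine (hf.sub hg).eq_zero ?_
  filter_upwards [hfg] with z hz
  rw [hz, sub_self]

end Expansion

lemma expansion_sub_center (c : ℂ) :
    Expansion (fun z => z - c) c (HahnSeries.single 1 1) := by
  simpa [taylor_sub_center] using Expansion.of_analyticAt (f := fun z => z - c) (c := c) (by fun_prop)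

lemma expansion_id (c : ℂ) :
    Expansion (fun z => z) c (HahnSeries.C c + HahnSeries.single 1 1) := by
  simpa using (Expansion.const (c := c) c).add (expansion_sub_center c)

lemma expansion_inv : Expansion (fun z => z⁻¹) 0 (HahnSeries.single (-1) 1) := by
  refine ⟨1, fun _ => 1, by fun_prop, ?_, ?_⟩
  · filter_upwards [self_mem_nhdsWithin] with z hz
    simp [show z ≠ 0 from hz]
  · rw [HahnSeries.single_mul_single, taylor_const]; simp

/-! ### Formal solutions -/

/-- Laurent series satisfying the system, where `S` times the formal derivative stands for the
derivation `t d/dt`, the series `T` is the expansion of `t`, and `u = q₁ p₁ + q₂ p₂`. -/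
structure FormalSolution (S T : LaurentSeries ℂ) (A α₀ α₁ : ℂ)
    (q₁ p₁ q₂ p₂ u : LaurentSeries ℂ) : Prop where
  u_eq : u = q₁ * p₁ + q₂ * p₂
  q₁_eq : S * dX q₁ = 2 * (q₁ * u) - q₁ * q₁ + HahnSeries.C A * q₁ - T + 4 * (T * p₂)
  p₁_eq : S * dX p₁ = HahnSeries.C α₀ - p₁ * (2 * u - 2 * q₁ + HahnSeries.C A)
  q₂_eq : S * dX q₂ = 2 * (q₂ * u) - q₂ * q₂ + HahnSeries.C A * q₂ - T + 4 * (T * p₁)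
  p₂_eq : S * dX p₂ = HahnSeries.C α₁ - p₂ * (2 * u - 2 * q₂ + HahnSeries.C A)

namespace FormalSolution

variable {S T : LaurentSeries ℂ} {A α₀ α₁ : ℂ} {q₁ p₁ q₂ p₂ u : LaurentSeries ℂ}

lemma swap (h : FormalSolution S T A α₀ α₁ q₁ p₁ q₂ p₂ u) :
    FormalSolution S T A α₁ α₀ q₂ p₂ q₁ p₁ u :=
  ⟨by rw [h.u_eq, add_comm], h.q₂_eq, h.p₂_eq, h.q₁_eq, h.p₁_eq⟩

/-- In the sum of the two momentum equations the terms `2 q₁ p₁ + 2 q₂ p₂` add up to `2 u`; the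
shift by 1 absorbs them, leaving a linear equation whose coefficient involves only `u`. -/
lemma sum_eq (h : FormalSolution S T A α₀ α₁ q₁ p₁ q₂ p₂ u) :
    S * dX (p₁ + p₂ - 1) =
      HahnSeries.C (α₀ + α₁ - A) - (p₁ + p₂ - 1) * (2 * u + HahnSeries.C A) := by
  rw [dX_sub, dX_add, dX_one, map_sub, map_add]
  linear_combination h.p₁_eq + h.p₂_eq - 2 * h.u_eq

end FormalSolution

/-- The derivative of the Hamiltonian along a solution. -/
noncomputable def formalEnergyDeriv (p₁ p₂ : LaurentSeries ℂ) : LaurentSeries ℂ :=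
  4 * (p₁ * p₂) - p₁ - p₂

/-- The expansion of the identity at `c`. -/
noncomputable def lin (c : ℂ) : LaurentSeries ℂ := HahnSeries.C c + HahnSeries.single 1 1

@[simp] lemma coeff_lin_mul (c : ℂ) (a : LaurentSeries ℂ) (n : ℤ) :
    (lin c * a).coeff n = c * a.coeff n + a.coeff (n - 1) := by
  simp [lin, add_mul, HahnSeries.coeff_single_mul]

lemma coeff_lin (c : ℂ) (n : ℤ) :
    (lin c).coeff n = (if n = 0 then c else 0) + if n = 1 then 1 else 0 := by
  rw [lin, HahnSeries.coeff_add, coeff_C, HahnSeries.coeff_single]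
  congr

lemma vanishesBelow_lin (c : ℂ) : VanishesBelow 0 (lin c) := fun i hi => by
  rw [coeff_lin, if_neg (by lia), if_neg (by lia), add_zero]

lemma VanishesBelow.lin_mul {n : ℤ} {a : LaurentSeries ℂ} (ha : VanishesBelow n a) (c : ℂ) :
    VanishesBelow n (lin c * a) := by
  simpa using (vanishesBelow_lin c).mul ha

lemma VanishesBelow.of_lin_mul {n : ℤ} {a : LaurentSeries ℂ} {c : ℂ} (hc : c ≠ 0)
    (ha : VanishesBelow n (lin c * a)) : VanishesBelow n a := by
  simpa using ha.of_mul (vanishesBelow_lin c) (by simpa [coeff_lin])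

/-! ### Formal solutions at a nonzero point -/

/-- A solution of a linear equation with a pole forces a simple pole of the coefficient. -/
lemma simple_pole_of_linear {c α : ℂ} {y w : LaurentSeries ℂ} {m : ℤ} (hm : m ≤ 0)
    (hy : VanishesBelow m y) (h0 : y.coeff m ≠ 0)
    (h : lin c * dX y = HahnSeries.C α - y * w) :
    VanishesBelow (-1) w ∧ w.coeff (-1) = -c * m := by
  -- As `m ≤ 0`, the right side has order at least `m - 1`, and dividing by `y` leaves order at
  -- least -1. The case `m = 0` is included: then `w` has no residue.
  have h1 : y * w = HahnSeries.C α - lin c * dX y := by rw [h]; ring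
  have hw : VanishesBelow (-1) w := by
    have h2 : VanishesBelow (m - 1) (y * w) := by
      rw [h1]
      exact ((vanishesBelow_C α).mono (by lia)).sub (hy.dX.lin_mul c)
    simpa using h2.of_mul hy h0
  refine ⟨hw, ?_⟩
  have h2 := hy.coeff_mul_lead hw (j := m - 1) rfl
  rw [h1] at h2
  simp only [HahnSeries.coeff_sub, coeff_C, if_neg (show m - 1 ≠ 0 by lia), coeff_lin_mul,
    coeff_dX, sub_add_cancel, hy (m - 1) (by lia)] at h2
  push_cast at h2
  apply mul_left_cancel₀ h0
  linear_combination -h2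

namespace FormalSolution

variable {c A α₀ α₁ : ℂ} {q₁ p₁ q₂ p₂ u : LaurentSeries ℂ}

lemma coeff_q₁ (h : FormalSolution (lin c) (lin c) A α₀ α₁ q₁ p₁ q₂ p₂ u) (n : ℤ) :
    c * ((n + 1) * q₁.coeff (n + 1)) + n * q₁.coeff n =
      2 * (q₁ * u).coeff n - (q₁ * q₁).coeff n + A * q₁.coeff n
        - ((if n = 0 then c else 0) + if n = 1 then 1 else 0)
        + 4 * (c * p₂.coeff n + p₂.coeff (n - 1)) := by
  have := congrArg (fun x => x.coeff n) h.q₁_eq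
  simpa [coeff_lin] using this

lemma coeff_u (h : FormalSolution (lin c) (lin c) A α₀ α₁ q₁ p₁ q₂ p₂ u) (n : ℤ) :
    u.coeff n = (q₁ * p₁).coeff n + (q₂ * p₂).coeff n := by
  rw [h.u_eq, HahnSeries.coeff_add]

/-- The equation for `q₁` is solved for `4 T p₂`. Since `lin c` has order 0, `p₂` is no more
singular than the derivative of `q₁`, `q₁ u` and `q₁²`. -/
lemma vanishesBelow_p₂ (h : FormalSolution (lin c) (lin c) A α₀ α₁ q₁ p₁ q₂ p₂ u) (hc : c ≠ 0)
    {m n : ℤ} (hq : VanishesBelow m q₁) (hqu : VanishesBelow n (q₁ * u)) (hm : m ≤ 0)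
    (h1 : n ≤ m - 1) (h2 : n ≤ m + m) : VanishesBelow n p₂ := by
  apply VanishesBelow.of_lin_mul hc
  intro i hi
  have e := congrArg (fun x => x.coeff i) h.q₁_eq
  simp only [HahnSeries.coeff_add, HahnSeries.coeff_sub, coeff_C_mul, coeff_two_mul, coeff_four_mul,
    (hq.dX.lin_mul c) i (by lia), hqu i hi, (hq.mul hq) i (by lia), hq i (by lia),
    vanishesBelow_lin c i (by lia)] at e
  linear_combination -e / 4

/-- The common part of the analysis of a pole of `p₁`. -/
lemma pole_p₁ (h : FormalSolution (lin c) (lin c) A α₀ α₁ q₁ p₁ q₂ p₂ u) {k : ℤ} (hk : 0 ≤ k)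
    (hp : VanishesBelow (-k) p₁) (h0 : p₁.coeff (-k) ≠ 0) :
    VanishesBelow (-1) (u - q₁) ∧ u.coeff (-1) - q₁.coeff (-1) = c * k / 2 := by
  obtain ⟨h1, h2⟩ := simple_pole_of_linear (by lia) hp h0 h.p₁_eq
  simp only [HahnSeries.coeff_add, HahnSeries.coeff_sub, coeff_two_mul, coeff_C,
    if_neg (show (-1 : ℤ) ≠ 0 by lia)] at h2
  push_cast at h2
  refine ⟨fun i hi => ?_, by linear_combination h2 / 2⟩
  have := h1 i hi
  simp only [HahnSeries.coeff_add, HahnSeries.coeff_sub, coeff_two_mul, coeff_C,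
    if_neg (show i ≠ 0 by lia)] at this
  rw [HahnSeries.coeff_sub]
  linear_combination this / 2

/-- Since `p₂` is regular, `p₁ + p₂ - 1` has the same pole as `p₁`, so `u` and `u - q₁` have the
same residue `c k / 2`. Hence `q₁` is regular, and in fact zero at `c`. Either `k = 1`, or `k = 2`
and the leading coefficient of `p₁` and the value of `p₂` are `(-c/2, 1/2)` or `(c, 0)`. -/
lemma energy_of_pole_p₁ (h : FormalSolution (lin c) (lin c) A α₀ α₁ q₁ p₁ q₂ p₂ u) (hc : c ≠ 0)
    {k : ℤ} (hk : 1 ≤ k) (hp : VanishesBelow (-k) p₁) (h0 : p₁.coeff (-k) ≠ 0)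
    (hp₂ : VanishesBelow 0 p₂) :
    VanishesBelow (-2) (formalEnergyDeriv p₁ p₂) ∧
      ∃ n : ℤ, (formalEnergyDeriv p₁ p₂).coeff (-2) = n * (c / 4) := by
  obtain ⟨hw, hw'⟩ := h.pole_p₁ (by lia) hp h0
  have hf : VanishesBelow (-k) (p₁ + p₂ - 1) :=
    (hp.add (hp₂.mono (by lia))).sub (vanishesBelow_one.mono (by lia))
  have hf0 : (p₁ + p₂ - 1).coeff (-k) ≠ 0 := by
    rw [HahnSeries.coeff_sub, HahnSeries.coeff_add, hp₂ (-k) (by lia),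
      vanishesBelow_one (-k) (by lia)]
    simpa using h0
  obtain ⟨h5, h5'⟩ := simple_pole_of_linear (by lia) hf hf0 h.sum_eq
  have hu : VanishesBelow (-1) u := by
    intro i hi
    have := h5 i hi
    simp only [HahnSeries.coeff_add, coeff_two_mul, coeff_C, if_neg (show i ≠ 0 by lia)] at this
    linear_combination this / 2
  have hu' : u.coeff (-1) = c * k / 2 := by
    simp only [HahnSeries.coeff_add, coeff_two_mul, coeff_C,
      if_neg (show (-1 : ℤ) ≠ 0 by lia)] at h5'
    push_cast at h5'
    linear_combination h5' / 2
  have hq : VanishesBelow 0 q₁ := by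
    have : VanishesBelow (-1) q₁ := by simpa using hu.sub hw
    exact this.succ (by linear_combination hu' - hw')
  -- At order -1 only `2 q₁ u` survives, and `u` has nonzero residue `c k / 2`.
  have hq0 : q₁.coeff 0 = 0 := by
    have e := h.coeff_q₁ (-1)
    rw [hq.coeff_mul_lead hu (j := -1) rfl, (hq.mul hq) (-1) (by lia), hq (-1) (by lia), hp₂ (-1) (by lia),
      hp₂ (-1 - 1) (by lia), hu'] at e
    norm_num at e
    rcases e with h | h | h
    · exact h
    · exact absurd h hc
    · lia
  have hq1 : VanishesBelow 1 q₁ := hq.succ hq0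
  have e1 : q₁.coeff 1 * (1 - k) = 4 * p₂.coeff 0 - 1 := by
    have e := h.coeff_q₁ 0
    rw [hq1.coeff_mul_lead hu (j := 0) rfl, (hq1.mul hq1) 0 (by lia), hq0, hp₂ (0 - 1) (by lia), hu'] at e
    norm_num at e
    apply mul_left_cancel₀ hc
    linear_combination e
  have hG : VanishesBelow (-k) (formalEnergyDeriv p₁ p₂) :=
    (((hp.mul hp₂).mono (by lia)).four_mul).sub hp |>.sub (hp₂.mono (by lia))
  rcases hk.eq_or_lt with rfl | hk
  · exact ⟨hG.mono (by lia), 0, by simpa using hG (-2) (by lia)⟩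
  suffices hs : VanishesBelow (-2) p₁ ∧ ((p₁.coeff (-2) = -c / 2 ∧ p₂.coeff 0 = 1 / 2) ∨
      (p₁.coeff (-2) = c ∧ p₂.coeff 0 = 0)) by
    obtain ⟨h2, h3⟩ := hs
    have : (formalEnergyDeriv p₁ p₂).coeff (-2) = (4 * p₂.coeff 0 - 1) * p₁.coeff (-2) := by
      simp only [formalEnergyDeriv, HahnSeries.coeff_sub, coeff_four_mul,
        h2.coeff_mul_lead hp₂ (j := -2) rfl, hp₂ (-2) (by lia)]
      ring
    refine ⟨(((h2.mul hp₂).mono (by lia)).four_mul).sub h2 |>.sub (hp₂.mono (by lia)), ?_⟩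
    rw [this]
    rcases h3 with ⟨h3, h4⟩ | ⟨h3, h4⟩ <;> rw [h3, h4]
    · exact ⟨-2, by push_cast; ring⟩
    · exact ⟨-4, by push_cast; ring⟩
  by_cases hp0 : p₂.coeff 0 = 0
  · have hp1 : VanishesBelow 1 p₂ := hp₂.succ hp0
    -- The zero of `p₂` cancels the simple pole of `u`, so the equation for `p₂` leaves no other
    -- singular term to balance `q₂ p₂`.
    have hqp : VanishesBelow 0 (q₂ * p₂) := by
      intro i hi
      have e := congrArg (fun x => x.coeff i) h.p₂_eq
      rw [show HahnSeries.C α₁ - p₂ * (2 * u - 2 * q₂ + HahnSeries.C A) =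
        HahnSeries.C α₁ - 2 * (p₂ * u) + 2 * (q₂ * p₂) - HahnSeries.C A * p₂ by ring] at e
      simp only [HahnSeries.coeff_add, HahnSeries.coeff_sub, coeff_C_mul, coeff_two_mul,
        (hp1.dX.lin_mul c) i (by lia), (hp1.mul hu) i (by lia), hp1 i (by lia),
        vanishesBelow_C α₁ i (by lia)] at e
      linear_combination -e / 2
    have hqp₁ : VanishesBelow (-1) (q₁ * p₁) := by
      rw [show q₁ * p₁ = u - q₂ * p₂ by rw [h.u_eq]; ring]
      exact hu.sub (hqp.mono (by lia))
    have hq1' : q₁.coeff 1 ≠ 0 := by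
      intro h
      rw [h, hp0] at e1
      norm_num at e1
    have hp2 : VanishesBelow (-2) p₁ := by simpa using hqp₁.of_mul hq1 hq1'
    have hk2 : k = 2 := by
      by_contra hne
      exact h0 (hp2 _ (by lia))
    subst hk2
    refine ⟨hp2, Or.inr ⟨?_, hp0⟩⟩
    have e := h.coeff_u (-1)
    rw [hq1.coeff_mul_lead hp2 (j := -1) rfl, hqp _ (by lia), hu'] at e
    rw [hp0] at e1
    push_cast at e1 e
    have : q₁.coeff 1 = 1 := by linear_combination -e1
    rw [this] at e
    linear_combination -e
  -- Pole order 0 is enough here: as `p₂` does not vanish at `c`, `u - q₂` has no residue and `q₂`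
  -- inherits that of `u`.
  · obtain ⟨hw2, hw2'⟩ := h.swap.pole_p₁ (k := 0) le_rfl (by simpa using hp₂) (by simpa using hp0)
    have hq₂ : VanishesBelow (-1) q₂ := by simpa using hu.sub hw2
    have hq₂' : q₂.coeff (-1) = c * k / 2 := by
      push_cast at hw2'
      linear_combination hu' - hw2'
    have hp2 : VanishesBelow (-2) p₁ :=
      h.swap.vanishesBelow_p₂ hc hq₂ (hq₂.mul hu) (by lia) (by lia) (by lia)
    have hk2 : k = 2 := by
      by_contra hne
      exact h0 (hp2 _ (by lia))
    subst hk2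
    have hP : p₁.coeff (-2) = -c / 2 := by
      have e := h.swap.coeff_q₁ (-2)
      rw [hq₂.coeff_mul_lead hu (j := -2) rfl, hq₂.coeff_mul_lead hq₂ (j := -2) rfl, hu', hq₂ (-2) (by lia),
        hp2 (-2 - 1) (by lia)] at e
      norm_num [hq₂'] at e
      apply mul_left_cancel₀ hc
      linear_combination -e / 4
    refine ⟨hp2, Or.inl ⟨hP, ?_⟩⟩
    have e := h.coeff_u (-1)
    rw [hq1.coeff_mul_lead hp2 (j := -1) rfl, hq₂.coeff_mul_lead hp₂ (j := -1) rfl, hu', hq₂', hP] at e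
    push_cast at e e1
    apply mul_left_cancel₀ hc
    linear_combination -e / 3 - e1 * c / 6

end FormalSolution
end SasanoA52

/-! ### Poles of both momenta at a nonzero point -/

namespace SasanoA52
namespace FormalSolution

variable {c A α₀ α₁ : ℂ} {q₁ p₁ q₂ p₂ u : LaurentSeries ℂ}

/-- If both `p₁` and `p₂` have poles, then `q₁` has at most a simple pole. -/
lemma simple_pole_q₁ (h : FormalSolution (lin c) (lin c) A α₀ α₁ q₁ p₁ q₂ p₂ u) (hc : c ≠ 0)
    (hw₁ : VanishesBelow (-1) (u - q₁)) (hw₂ : VanishesBelow (-1) (u - q₂)) :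
    VanishesBelow (-1) q₁ := by
  by_contra hq
  obtain ⟨m, hm, hqm, hq0⟩ := exists_leading_of_not_vanishesBelow hq
  have hum : VanishesBelow m u := by simpa using (hw₁.mono hm.le).add hqm
  have hqm₂ : VanishesBelow m q₂ := by simpa using hum.sub (hw₂.mono hm.le)
  have hu0 : u.coeff m = q₁.coeff m := by
    have := hw₁ m hm
    rw [HahnSeries.coeff_sub] at this
    linear_combination this
  have hq₂0 : q₂.coeff m = q₁.coeff m := by
    have := hw₂ m hm
    rw [HahnSeries.coeff_sub] at this
    linear_combination hu0 - this
  -- Let `x` be the common leading coefficient of `q₁`, `q₂`, `u`. As `m ≤ -2`, derivatives do not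
  -- reach order `2m`, where the equations give `4 c p₁ = 4 c p₂ = -x²`. But `u` has no term of
  -- order `3m`, so `x (p₁ + p₂) = 0` and `x³ = 0`.
  have hp₂ : VanishesBelow (m + m) p₂ :=
    h.vanishesBelow_p₂ hc hqm (hqm.mul hum) (by lia) (by lia) le_rfl
  have hp₁ : VanishesBelow (m + m) p₁ :=
    h.swap.vanishesBelow_p₂ hc hqm₂ (hqm₂.mul hum) (by lia) (by lia) le_rfl
  have e₂ := h.coeff_q₁ (m + m)
  rw [hqm.coeff_mul_lead hum rfl, hqm.coeff_mul_lead hqm rfl, hqm (m + m) (by lia),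
    hqm (m + m + 1) (by lia), hp₂ (m + m - 1) (by lia), hu0, if_neg (by lia), if_neg (by lia)] at e₂
  have e₁ := h.swap.coeff_q₁ (m + m)
  rw [hqm₂.coeff_mul_lead hum rfl, hqm₂.coeff_mul_lead hqm₂ rfl, hqm₂ (m + m) (by lia),
    hqm₂ (m + m + 1) (by lia), hp₁ (m + m - 1) (by lia), hu0, hq₂0, if_neg (by lia),
    if_neg (by lia)] at e₁
  have e := h.coeff_u (m + (m + m))
  rw [hqm.coeff_mul_lead hp₁ rfl, hqm₂.coeff_mul_lead hp₂ rfl, hum _ (by lia), hq₂0] at e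
  have : q₁.coeff m ^ 3 = 0 := by
    linear_combination 2 * c * e - q₁.coeff m * e₁ / 2 - q₁.coeff m * e₂ / 2
  exact hq0 (by simpa using this)

/-- `p₁` and `p₂` cannot have a double and a simple pole, respectively. -/
lemma not_double_simple_pole (h : FormalSolution (lin c) (lin c) A α₀ α₁ q₁ p₁ q₂ p₂ u)
    (hc : c ≠ 0) (hp₁ : VanishesBelow (-2) p₁) (hp₁0 : p₁.coeff (-2) ≠ 0)
    (hp₂ : VanishesBelow (-1) p₂) (hp₂0 : p₂.coeff (-1) ≠ 0) : False := by
  obtain ⟨hw₁, hw₁'⟩ := h.pole_p₁ (by lia) hp₁ hp₁0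
  obtain ⟨hw₂, hw₂'⟩ := h.swap.pole_p₁ (by lia) hp₂ hp₂0
  have hq₁ := h.simple_pole_q₁ hc hw₁ hw₂
  have hu : VanishesBelow (-1) u := by simpa using hw₁.add hq₁
  have hq₂ : VanishesBelow (-1) q₂ := by simpa using hu.sub hw₂
  push_cast at hw₁' hw₂'
  have hx : q₁.coeff (-1) = 0 := by
    have e := h.coeff_u (-3)
    rw [hq₁.coeff_mul_lead hp₁ (j := -3) rfl, (hq₂.mul hp₂) (-3) (by lia), hu (-3) (by lia)] at e
    have : q₁.coeff (-1) * p₁.coeff (-2) = 0 := by linear_combination -e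
    exact (mul_eq_zero.mp this).resolve_right hp₁0
  have hq₁0 : VanishesBelow 0 q₁ := hq₁.succ hx
  have hU : u.coeff (-1) = c := by linear_combination hw₁' + hx
  have hx₂ : q₂.coeff (-1) = c / 2 := by linear_combination hU - hw₂'
  have hP : p₁.coeff (-2) = -5 * c / 16 := by
    have e := h.swap.coeff_q₁ (-2)
    rw [hq₂.coeff_mul_lead hu (j := -2) rfl, hq₂.coeff_mul_lead hq₂ (j := -2) rfl,
      hq₂ (-2) (by lia), hp₁ (-2 - 1) (by lia), hU, if_neg (by lia), if_neg (by lia)] at e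
    norm_num [hx₂] at e
    apply mul_left_cancel₀ hc
    linear_combination -e / 4
  have e₁ := h.coeff_q₁ (-1)
  rw [hq₁0.coeff_mul_lead hu (j := -1) rfl, (hq₁0.mul hq₁0) (-1) (by lia), hx, hU,
    hp₂ (-1 - 1) (by lia), if_neg (by lia), if_neg (by lia)] at e₁
  push_cast at e₁
  have e₂ := h.coeff_u (-2)
  rw [hq₁0.coeff_mul_lead hp₁ (j := -2) rfl, hq₂.coeff_mul_lead hp₂ (j := -2) rfl,
    hu (-2) (by lia), hP, hx₂] at e₂
  have hR : p₂.coeff (-1) = -q₁.coeff 0 / 2 := by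
    apply mul_left_cancel₀ hc
    norm_num at e₁
    linear_combination -e₁ / 4
  -- `hR` and `e₂` are independent homogeneous linear relations between `q₁.coeff 0` and `p₂.coeff
  -- (-1)`.
  have : c * p₂.coeff (-1) = 0 := by
    linear_combination -8 / 9 * e₂ + 5 / 9 * c * hR
  exact mul_ne_zero hc hp₂0 this

/-- `p₁` and `p₂` cannot both have a double pole. -/
lemma not_double_double_pole (h : FormalSolution (lin c) (lin c) A α₀ α₁ q₁ p₁ q₂ p₂ u)
    (hc : c ≠ 0) (hp₁ : VanishesBelow (-2) p₁) (hp₁0 : p₁.coeff (-2) ≠ 0)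
    (hp₂ : VanishesBelow (-2) p₂) (hp₂0 : p₂.coeff (-2) ≠ 0) : False := by
  obtain ⟨hw₁, hw₁'⟩ := h.pole_p₁ (by lia) hp₁ hp₁0
  obtain ⟨hw₂, hw₂'⟩ := h.swap.pole_p₁ (by lia) hp₂ hp₂0
  have hq₁ := h.simple_pole_q₁ hc hw₁ hw₂
  have hu : VanishesBelow (-1) u := by simpa using hw₁.add hq₁
  have hq₂ : VanishesBelow (-1) q₂ := by simpa using hu.sub hw₂
  have hx : q₂.coeff (-1) = q₁.coeff (-1) := by linear_combination hw₁' - hw₂'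
  have e₁ := h.coeff_q₁ (-2)
  rw [hq₁.coeff_mul_lead hu (j := -2) rfl, hq₁.coeff_mul_lead hq₁ (j := -2) rfl,
    hq₁ (-2) (by lia), hp₂ (-2 - 1) (by lia), if_neg (by lia), if_neg (by lia)] at e₁
  have e₂ := h.swap.coeff_q₁ (-2)
  rw [hq₂.coeff_mul_lead hu (j := -2) rfl, hq₂.coeff_mul_lead hq₂ (j := -2) rfl,
    hq₂ (-2) (by lia), hp₁ (-2 - 1) (by lia), if_neg (by lia), if_neg (by lia)] at e₂
  have e₃ := h.coeff_u (-3)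
  rw [hq₁.coeff_mul_lead hp₁ (j := -3) rfl, hq₂.coeff_mul_lead hp₂ (j := -3) rfl,
    hu (-3) (by lia), hx] at e₃
  norm_num [hx] at e₁ e₂
  have hP : p₂.coeff (-2) = p₁.coeff (-2) := by
    apply mul_left_cancel₀ hc
    linear_combination (e₂ - e₁) / 4
  -- `u` has no term of order -3, while equal residues of the `q`s and equal leading coefficients of
  -- the `p`s make the two products add up.
  have h0 : q₁.coeff (-1) = 0 := by
    have : q₁.coeff (-1) * p₁.coeff (-2) = 0 := by
      linear_combination -e₃ / 2 - q₁.coeff (-1) * hP / 2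
    exact (mul_eq_zero.mp this).resolve_right hp₁0
  rw [h0] at e₂
  have : c * p₁.coeff (-2) = 0 := by linear_combination -e₂ / 4
  exact mul_ne_zero hc hp₁0 this

/-- The case in which `p₁` and `p₂` both have a simple pole. -/
lemma mul_residues (h : FormalSolution (lin c) (lin c) A α₀ α₁ q₁ p₁ q₂ p₂ u)
    (hc : c ≠ 0) (hp₁ : VanishesBelow (-1) p₁) (hp₁0 : p₁.coeff (-1) ≠ 0)
    (hp₂ : VanishesBelow (-1) p₂) (hp₂0 : p₂.coeff (-1) ≠ 0) :
    p₁.coeff (-1) * p₂.coeff (-1) = -c / 16 := by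
  obtain ⟨hw₁, hw₁'⟩ := h.pole_p₁ (by lia) hp₁ hp₁0
  obtain ⟨hw₂, hw₂'⟩ := h.swap.pole_p₁ (by lia) hp₂ hp₂0
  have hq₁ := h.simple_pole_q₁ hc hw₁ hw₂
  have hu : VanishesBelow (-1) u := by simpa using hw₁.add hq₁
  have hq₂ : VanishesBelow (-1) q₂ := by simpa using hu.sub hw₂
  push_cast at hw₁' hw₂'
  have hx : q₂.coeff (-1) = q₁.coeff (-1) := by linear_combination hw₁' - hw₂'
  have hU : u.coeff (-1) = q₁.coeff (-1) + c / 2 := by linear_combination hw₁'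
  have e₁ := h.coeff_q₁ (-2)
  rw [hq₁.coeff_mul_lead hu (j := -2) rfl, hq₁.coeff_mul_lead hq₁ (j := -2) rfl,
    hq₁ (-2) (by lia), hp₂ (-2 - 1) (by lia), hp₂ (-2) (by lia), hU, if_neg (by lia),
    if_neg (by lia)] at e₁
  norm_num at e₁
  have e₂ := h.coeff_u (-2)
  rw [hq₁.coeff_mul_lead hp₁ (j := -2) rfl, hq₂.coeff_mul_lead hp₂ (j := -2) rfl,
    hu (-2) (by lia), hx] at e₂
  have e₃ := h.coeff_u (-1)
  rw [hq₁.coeff_mul_next hp₁ (j := -1) rfl, hq₂.coeff_mul_next hp₂ (j := -1) rfl, hU, hx] at e₃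
  have e₄ := h.coeff_q₁ (-1)
  rw [hq₁.coeff_mul_next hu (j := -1) rfl, hq₁.coeff_mul_next hq₁ (j := -1) rfl, hU,
    hp₂ (-1 - 1) (by lia), if_neg (by lia), if_neg (by lia)] at e₄
  have e₅ := h.swap.coeff_q₁ (-1)
  rw [hq₂.coeff_mul_next hu (j := -1) rfl, hq₂.coeff_mul_next hq₂ (j := -1) rfl, hU, hx,
    hp₁ (-1 - 1) (by lia), if_neg (by lia), if_neg (by lia)] at e₅
  norm_num at e₃ e₄ e₅
  -- Order -2 of the equation for `q₁` is a quadratic in the common residue of `q₁` and `q₂`; both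
  -- roots lead to the same product of residues.
  have hcases : q₁.coeff (-1) = 0 ∨ q₁.coeff (-1) = -2 * c := by
    have : q₁.coeff (-1) * (q₁.coeff (-1) + 2 * c) = 0 := by linear_combination -e₁
    rcases mul_eq_zero.mp this with h | h
    · exact Or.inl h
    · exact Or.inr (by linear_combination h)
  rcases hcases with h0 | h0
  · rw [h0] at e₃ e₄ e₅
    have h₂ : p₂.coeff (-1) = -q₁.coeff 0 / 4 := by
      apply mul_left_cancel₀ hc
      linear_combination -e₄ / 4
    have h₁ : p₁.coeff (-1) = -q₂.coeff 0 / 4 := by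
      apply mul_left_cancel₀ hc
      linear_combination -e₅ / 4
    linear_combination e₃ / 8 + p₁.coeff (-1) * h₂ / 2 + p₂.coeff (-1) * h₁ / 2
  · have hR : p₂.coeff (-1) = -p₁.coeff (-1) := by
      rw [h0] at e₂
      apply mul_left_cancel₀ hc
      linear_combination e₂ / 2
    -- The residues of `p₁` and `p₂` cancel, so the sum is regular; since `u` has residue `-3c/2 ≠
    -- 0`, the linear equation `sum_eq` forces `p₁ + p₂ - 1` to vanish at `c`.
    have hf : VanishesBelow 0 (p₁ + p₂ - 1) := by
      refine ((hp₁.add hp₂).succ ?_).sub vanishesBelow_one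
      rw [HahnSeries.coeff_add, hR, add_neg_cancel]
    have hf0 : p₁.coeff 0 + p₂.coeff 0 = 1 := by
      have e := congrArg (fun x => x.coeff (-1)) h.sum_eq
      rw [show HahnSeries.C (α₀ + α₁ - A) - (p₁ + p₂ - 1) * (2 * u + HahnSeries.C A) =
        HahnSeries.C (α₀ + α₁ - A) - 2 * ((p₁ + p₂ - 1) * u)
          - HahnSeries.C A * (p₁ + p₂ - 1) by ring] at e
      simp only [HahnSeries.coeff_sub, coeff_C_mul, coeff_two_mul, coeff_lin_mul, coeff_dX,
        hf.coeff_mul_lead hu (j := -1) rfl, vanishesBelow_C _ (-1) (by lia)] at e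
      rw [hU, h0] at e
      have h2 := hf (-1) (by lia)
      simp only [HahnSeries.coeff_sub, HahnSeries.coeff_add, HahnSeries.coeff_one] at e h2
      norm_num [h2] at e
      have h1 : c * (p₁.coeff 0 + p₂.coeff 0 - 1) = 0 := by
        linear_combination -e / 3 + (A - 1) / 3 * hR
      linear_combination (mul_eq_zero.mp h1).resolve_left hc
    rw [h0] at e₃ e₄ e₅
    have h3 : q₁.coeff 0 - q₂.coeff 0 = 8 * p₁.coeff (-1) := by
      apply mul_left_cancel₀ hc
      linear_combination e₅ - e₄ - 4 * c * hR
    rw [hR] at e₃ ⊢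
    linear_combination e₃ / 8 - c / 4 * hf0 + p₁.coeff (-1) / 8 * h3

/-- The `q`s have at most simple poles, hence the `p`s at most double ones. Only the pair of simple
poles is possible, and then the coefficient is four times the product of the residues. -/
lemma energy_of_poles (h : FormalSolution (lin c) (lin c) A α₀ α₁ q₁ p₁ q₂ p₂ u) (hc : c ≠ 0)
    {k l : ℤ} (hk : 1 ≤ k) (hp₁ : VanishesBelow (-k) p₁) (hp₁0 : p₁.coeff (-k) ≠ 0)
    (hl : 1 ≤ l) (hp₂ : VanishesBelow (-l) p₂) (hp₂0 : p₂.coeff (-l) ≠ 0) :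
    VanishesBelow (-2) (formalEnergyDeriv p₁ p₂) ∧
      (formalEnergyDeriv p₁ p₂).coeff (-2) = -(c / 4) := by
  obtain ⟨hw₁, -⟩ := h.pole_p₁ (by lia) hp₁ hp₁0
  obtain ⟨hw₂, -⟩ := h.swap.pole_p₁ (by lia) hp₂ hp₂0
  have hq₁ := h.simple_pole_q₁ hc hw₁ hw₂
  have hu : VanishesBelow (-1) u := by simpa using hw₁.add hq₁
  have hq₂ : VanishesBelow (-1) q₂ := by simpa using hu.sub hw₂
  have hp₂2 : VanishesBelow (-2) p₂ :=
    h.vanishesBelow_p₂ hc hq₁ (hq₁.mul hu) (by lia) (by lia) (by lia)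
  have hp₁2 : VanishesBelow (-2) p₁ :=
    h.swap.vanishesBelow_p₂ hc hq₂ (hq₂.mul hu) (by lia) (by lia) (by lia)
  have hk2 : k ≤ 2 := by
    by_contra! hlt
    exact hp₁0 (hp₁2 _ (by lia))
  have hl2 : l ≤ 2 := by
    by_contra! hlt
    exact hp₂0 (hp₂2 _ (by lia))
  obtain rfl | rfl : k = 1 ∨ k = 2 := by lia
  · obtain rfl | rfl : l = 1 ∨ l = 2 := by lia
    · refine ⟨((hp₁.mul hp₂).four_mul.sub (hp₁.mono (by lia))).sub (hp₂.mono (by lia)), ?_⟩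
      simp only [formalEnergyDeriv, HahnSeries.coeff_sub, coeff_four_mul,
        hp₁.coeff_mul_lead hp₂ (j := -2) rfl, hp₁ (-2) (by lia), hp₂ (-2) (by lia),
        h.mul_residues hc hp₁ hp₁0 hp₂ hp₂0]
      ring
    · exact (h.swap.not_double_simple_pole hc hp₂ hp₂0 hp₁ hp₁0).elim
  · obtain rfl | rfl : l = 1 ∨ l = 2 := by lia
    · exact (h.not_double_simple_pole hc hp₁ hp₁0 hp₂ hp₂0).elim
    · exact (h.not_double_double_pole hc hp₁ hp₁0 hp₂ hp₂0).elim

/-- The derivative of the Hamiltonian has at most a double pole at `c`, with coefficient a multiple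
of `c / 4`. -/
theorem energy (h : FormalSolution (lin c) (lin c) A α₀ α₁ q₁ p₁ q₂ p₂ u) (hc : c ≠ 0) :
    VanishesBelow (-2) (formalEnergyDeriv p₁ p₂) ∧
      ∃ n : ℤ, (formalEnergyDeriv p₁ p₂).coeff (-2) = n * (c / 4) := by
  by_cases h₁ : VanishesBelow 0 p₁ <;> by_cases h₂ : VanishesBelow 0 p₂
  · have : VanishesBelow 0 (formalEnergyDeriv p₁ p₂) := ((h₁.mul h₂).four_mul.sub h₁).sub h₂
    exact ⟨this.mono (by lia), 0, by simpa using this (-2) (by lia)⟩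
  · obtain ⟨m, hm, h3, h4⟩ := exists_leading_of_not_vanishesBelow h₂
    have := h.swap.energy_of_pole_p₁ hc (k := -m) (by lia) (by simpa) (by simpa) h₁
    rwa [show formalEnergyDeriv p₂ p₁ = formalEnergyDeriv p₁ p₂ by
      unfold formalEnergyDeriv; ring] at this
  · obtain ⟨m, hm, h3, h4⟩ := exists_leading_of_not_vanishesBelow h₁
    exact h.energy_of_pole_p₁ hc (k := -m) (by lia) (by simpa) (by simpa) h₂
  · obtain ⟨m, hm, h3, h4⟩ := exists_leading_of_not_vanishesBelow h₁
    obtain ⟨n, hn, h5, h6⟩ := exists_leading_of_not_vanishesBelow h₂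
    obtain ⟨h7, h8⟩ := h.energy_of_poles hc (k := -m) (l := -n) (by lia) (by simpa) (by simpa)
      (by lia) (by simpa) (by simpa)
    exact ⟨h7, -1, by rw [h8]; push_cast; ring⟩

end FormalSolution
/-- The Hamiltonian of a formal solution. -/
noncomputable def formalEnergy (T : LaurentSeries ℂ) (A α₀ α₁ : ℂ)
    (q₁ p₁ q₂ p₂ u : LaurentSeries ℂ) : LaurentSeries ℂ :=
  u * u - q₁ * (q₁ * p₁) - q₂ * (q₂ * p₂) + HahnSeries.C A * u - HahnSeries.C α₀ * q₁
    - HahnSeries.C α₁ * q₂ + T * formalEnergyDeriv p₁ p₂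

lemma formalEnergy_swap (T : LaurentSeries ℂ) (A α₀ α₁ : ℂ) (q₁ p₁ q₂ p₂ u : LaurentSeries ℂ) :
    formalEnergy T A α₁ α₀ q₂ p₂ q₁ p₁ u = formalEnergy T A α₀ α₁ q₁ p₁ q₂ p₂ u := by
  unfold formalEnergy formalEnergyDeriv; ring

/-! ### Formal solutions at the origin -/

lemma coeff_eq_of_vanishesBelow_sub {m n : ℤ} {a b : LaurentSeries ℂ}
    (h : VanishesBelow n (a - b)) (hm : m < n) : a.coeff m = b.coeff m := by
  have := h m hm
  rw [HahnSeries.coeff_sub] at this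
  linear_combination this

/-- A nonzero solution of a linear equation forces the coefficient to be regular. -/
lemma regular_of_linear {S : LaurentSeries ℂ} {α ε : ℂ} {y w : LaurentSeries ℂ} {m : ℤ}
    (hS : ∀ n, (S * dX y).coeff n = ε * n * y.coeff n) (hm : m ≤ 0)
    (hy : VanishesBelow m y) (h0 : y.coeff m ≠ 0) (h : S * dX y = HahnSeries.C α - y * w) :
    VanishesBelow 0 w ∧ (m < 0 → w.coeff 0 = -ε * m) := by
  -- By `hS` the derivation preserves orders, so, unlike at `c ≠ 0`, the quotient by `y` has no
  -- pole. It is applied with `ε = 1` at the origin and `ε = -1` at infinity.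
  have h1 : y * w = HahnSeries.C α - S * dX y := by rw [h]; ring
  have h2 : ∀ i, (y * w).coeff i = (if i = 0 then α else 0) - ε * i * y.coeff i := by
    intro i
    rw [h1, HahnSeries.coeff_sub, coeff_C, hS]
  have hw : VanishesBelow 0 w := by
    have h2 : VanishesBelow m (y * w) := fun i hi => by
      rw [h2, hy i hi, if_neg (by lia)]; ring
    simpa using h2.of_mul hy h0
  refine ⟨hw, fun hm => ?_⟩
  have h3 := hy.coeff_mul_lead hw (j := m) (by lia)
  rw [h2, if_neg hm.ne] at h3
  apply mul_left_cancel₀ h0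
  linear_combination -h3

lemma coeff_euler_zero (y : LaurentSeries ℂ) (n : ℤ) :
    (lin 0 * dX y).coeff n = 1 * n * y.coeff n := by
  simp only [coeff_lin_mul, coeff_dX, sub_add_cancel]
  push_cast
  ring

namespace FormalSolution

variable {A α₀ α₁ : ℂ} {q₁ p₁ q₂ p₂ u : LaurentSeries ℂ}

lemma coeff_q₁_zero (h : FormalSolution (lin 0) (lin 0) A α₀ α₁ q₁ p₁ q₂ p₂ u) (n : ℤ) :
    n * q₁.coeff n = 2 * (q₁ * u).coeff n - (q₁ * q₁).coeff n + A * q₁.coeff n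
        - (if n = 1 then 1 else 0) + 4 * p₂.coeff (n - 1) := by
  simpa using h.coeff_q₁ n

lemma coeff_p₁_zero (h : FormalSolution (lin 0) (lin 0) A α₀ α₁ q₁ p₁ q₂ p₂ u) (n : ℤ) :
    n * p₁.coeff n = (if n = 0 then α₀ else 0) - 2 * (p₁ * u).coeff n + 2 * (p₁ * q₁).coeff n
      - A * p₁.coeff n := by
  have e := congrArg (fun x => x.coeff n) h.p₁_eq
  rw [show HahnSeries.C α₀ - p₁ * (2 * u - 2 * q₁ + HahnSeries.C A) =
    HahnSeries.C α₀ - 2 * (p₁ * u) + 2 * (p₁ * q₁) - HahnSeries.C A * p₁ by ring] at e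
  simp only [HahnSeries.coeff_add, HahnSeries.coeff_sub, coeff_C_mul, coeff_two_mul, coeff_C,
    coeff_lin_mul, coeff_dX, sub_add_cancel] at e
  push_cast at e
  linear_combination e

lemma pole_p₁_zero (h : FormalSolution (lin 0) (lin 0) A α₀ α₁ q₁ p₁ q₂ p₂ u) {m : ℤ}
    (hm : m < 0) (hp : VanishesBelow m p₁) (h0 : p₁.coeff m ≠ 0) :
    VanishesBelow 0 (u - q₁) ∧ u.coeff 0 - q₁.coeff 0 = (-m - A) / 2 := by
  obtain ⟨h1, h2⟩ := regular_of_linear (coeff_euler_zero _) hm.le hp h0 h.p₁_eq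
  have h2 := h2 hm
  simp only [HahnSeries.coeff_add, HahnSeries.coeff_sub, coeff_two_mul, coeff_C, if_true] at h2
  refine ⟨fun i hi => ?_, by linear_combination h2 / 2⟩
  have := h1 i hi
  simp only [HahnSeries.coeff_add, HahnSeries.coeff_sub, coeff_two_mul, coeff_C,
    if_neg hi.ne] at this
  rw [HahnSeries.coeff_sub]
  linear_combination this / 2

lemma vanishesBelow_p₂_zero (h : FormalSolution (lin 0) (lin 0) A α₀ α₁ q₁ p₁ q₂ p₂ u)
    {m n : ℤ} (hq : VanishesBelow m q₁) (hqu : VanishesBelow n (q₁ * u)) (hm : m ≤ 0)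
    (h1 : n ≤ m) (h2 : n ≤ m + m) : VanishesBelow (n - 1) p₂ := by
  intro i hi
  have e := h.coeff_q₁_zero (i + 1)
  rw [hqu _ (by lia), (hq.mul hq) _ (by lia), hq _ (by lia), if_neg (by lia),
    add_sub_cancel_right] at e
  linear_combination -e / 4

/-- The cubic argument of `simple_pole_q₁` now makes `q₁` regular. Then `q₁`, `q₂` share a value `x`
and `p₁`, `p₂` have simple poles with equal residues `P`; regularity of `u` gives `2 x P = 0`, so `x
= 0`, and the equation for `q₁` gives `P = 0`. -/
lemma not_both_poles_zero (h : FormalSolution (lin 0) (lin 0) A α₀ α₁ q₁ p₁ q₂ p₂ u)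
    (h₁ : ¬ VanishesBelow 0 p₁) (h₂ : ¬ VanishesBelow 0 p₂) : False := by
  obtain ⟨k, hk, hp₁, hp₁0⟩ := exists_leading_of_not_vanishesBelow h₁
  obtain ⟨l, hl, hp₂, hp₂0⟩ := exists_leading_of_not_vanishesBelow h₂
  obtain ⟨hd₁, hd₁'⟩ := h.pole_p₁_zero hk hp₁ hp₁0
  obtain ⟨hd₂, hd₂'⟩ := h.swap.pole_p₁_zero hl hp₂ hp₂0
  have hq₁ : VanishesBelow 0 q₁ := by
    by_contra hq
    obtain ⟨m, hm, hqm, hq0⟩ := exists_leading_of_not_vanishesBelow hq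
    have hum : VanishesBelow m u := by simpa using (hd₁.mono hm.le).add hqm
    have hqm₂ : VanishesBelow m q₂ := by simpa using hum.sub (hd₂.mono hm.le)
    have hu0 : u.coeff m = q₁.coeff m := coeff_eq_of_vanishesBelow_sub hd₁ hm
    have hq₂0 : q₂.coeff m = q₁.coeff m := by
      rw [← hu0, coeff_eq_of_vanishesBelow_sub hd₂ hm]
    have hp₂ : VanishesBelow (m + m - 1) p₂ :=
      h.vanishesBelow_p₂_zero hqm (hqm.mul hum) (by lia) (by lia) le_rfl
    have hp₁ : VanishesBelow (m + m - 1) p₁ :=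
      h.swap.vanishesBelow_p₂_zero hqm₂ (hqm₂.mul hum) (by lia) (by lia) le_rfl
    have e₂ := h.coeff_q₁_zero (m + m)
    rw [hqm.coeff_mul_lead hum rfl, hqm.coeff_mul_lead hqm rfl, hqm (m + m) (by lia), hu0,
      if_neg (by lia)] at e₂
    have e₁ := h.swap.coeff_q₁_zero (m + m)
    rw [hqm₂.coeff_mul_lead hum rfl, hqm₂.coeff_mul_lead hqm₂ rfl, hqm₂ (m + m) (by lia), hu0,
      hq₂0, if_neg (by lia)] at e₁
    have e := h.coeff_u (m + (m + m - 1))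
    rw [hqm.coeff_mul_lead hp₁ rfl, hqm₂.coeff_mul_lead hp₂ rfl, hum _ (by lia), hq₂0] at e
    have : q₁.coeff m ^ 3 = 0 := by
      linear_combination 2 * e - q₁.coeff m * e₁ / 2 - q₁.coeff m * e₂ / 2
    exact hq0 (by simpa using this)
  have hu : VanishesBelow 0 u := by simpa using hd₁.add hq₁
  have hq₂ : VanishesBelow 0 q₂ := by simpa using hu.sub hd₂
  have hp₂' : VanishesBelow (-1) p₂ :=
    h.vanishesBelow_p₂_zero hq₁ (hq₁.mul hu) le_rfl (by lia) (by lia)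
  have hp₁' : VanishesBelow (-1) p₁ :=
    h.swap.vanishesBelow_p₂_zero hq₂ (hq₂.mul hu) le_rfl (by lia) (by lia)
  obtain rfl : k = -1 := by
    by_contra hne
    exact hp₁0 (hp₁' _ (by lia))
  obtain rfl : l = -1 := by
    by_contra hne
    exact hp₂0 (hp₂' _ (by lia))
  have hx : q₂.coeff 0 = q₁.coeff 0 := by linear_combination hd₁' - hd₂'
  have e₁ := h.coeff_q₁_zero 0
  rw [hq₁.coeff_mul_lead hu (j := 0) rfl, hq₁.coeff_mul_lead hq₁ (j := 0) rfl] at e₁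
  have e₂ := h.swap.coeff_q₁_zero 0
  rw [hq₂.coeff_mul_lead hu (j := 0) rfl, hq₂.coeff_mul_lead hq₂ (j := 0) rfl, hx] at e₂
  have e := h.coeff_u (-1)
  rw [hq₁.coeff_mul_lead hp₁ (j := -1) rfl, hq₂.coeff_mul_lead hp₂ (j := -1) rfl,
    hu (-1) (by lia), hx] at e
  norm_num at e₁ e₂
  have hR : p₂.coeff (-1) = p₁.coeff (-1) := by linear_combination (e₂ - e₁) / 4
  have h0 : q₁.coeff 0 = 0 := by
    have : q₁.coeff 0 * p₁.coeff (-1) = 0 := by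
      linear_combination -e / 2 - q₁.coeff 0 * hR / 2
    exact (mul_eq_zero.mp this).resolve_right hp₁0
  rw [h0] at e₁
  exact hp₂0 (by linear_combination -e₁ / 4)

/-- The case in which `p₁` has a pole at the origin. -/
theorem pole_zero (h : FormalSolution (lin 0) (lin 0) A α₀ α₁ q₁ p₁ q₂ p₂ u)
    (h₁ : ¬ VanishesBelow 0 p₁) :
    VanishesBelow 0 q₁ ∧ VanishesBelow 0 q₂ ∧ VanishesBelow 0 p₂ ∧
      (formalEnergy (lin 0) A α₀ α₁ q₁ p₁ q₂ p₂ u).coeff 0 =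
        -(1 / 4) * A ^ 2 + α₁ ^ 2 + 3 / 16 := by
  have hp₂ : VanishesBelow 0 p₂ := by
    by_contra h₂
    exact h.not_both_poles_zero h₁ h₂
  obtain ⟨k, hk, hp₁, hp₁0⟩ := exists_leading_of_not_vanishesBelow h₁
  obtain ⟨hd, hd'⟩ := h.pole_p₁_zero hk hp₁ hp₁0
  have hf : VanishesBelow k (p₁ + p₂ - 1) :=
    (hp₁.add (hp₂.mono (by lia))).sub (vanishesBelow_one.mono (by lia))
  have hf0 : (p₁ + p₂ - 1).coeff k ≠ 0 := by
    rw [HahnSeries.coeff_sub, HahnSeries.coeff_add, hp₂ k hk, vanishesBelow_one k hk]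
    simpa using hp₁0
  obtain ⟨h5, h5'⟩ := regular_of_linear (coeff_euler_zero _) hk.le hf hf0 h.sum_eq
  have hu : VanishesBelow 0 u := by
    intro i hi
    have := h5 i hi
    simp only [HahnSeries.coeff_add, coeff_two_mul, coeff_C, if_neg hi.ne] at this
    linear_combination this / 2
  have hu0 : u.coeff 0 = (-k - A) / 2 := by
    have := h5' hk
    simp only [HahnSeries.coeff_add, coeff_two_mul, coeff_C, if_true] at this
    linear_combination this / 2
  have hq₁ : VanishesBelow 0 q₁ := by simpa using hu.sub hd
  have hq₁0 : q₁.coeff 0 = 0 := by linear_combination hu0 - hd'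
  have hq₁1 : VanishesBelow 1 q₁ := hq₁.succ hq₁0
  have e₁ := h.coeff_q₁_zero 1
  rw [hq₁1.coeff_mul_lead hu (j := 1) rfl, (hq₁1.mul hq₁1) 1 (by lia), hu0, if_pos rfl,
    sub_self] at e₁
  have hqp : VanishesBelow 0 (p₂ * q₂) := by
    intro i hi
    have e := h.swap.coeff_p₁_zero i
    rw [hp₂ i hi, (hp₂.mul hu) i hi, if_neg hi.ne] at e
    linear_combination -e / 2
  have hqp₁ : VanishesBelow 0 (q₁ * p₁) := by
    rw [show q₁ * p₁ = u - p₂ * q₂ by rw [h.u_eq]; ring]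
    exact hu.sub hqp
  -- A pole of `q₂` forces `p₂` to vanish at 0, since `p₂ q₂` is regular. Then `q₁` has a simple
  -- zero, `p₁` at most a simple pole, and nothing balances `q₂²` in the equation for `q₂`.
  have hq₂ : VanishesBelow 0 q₂ := by
    by_contra hq₂
    obtain ⟨m, hm, hqm, hqm0⟩ := exists_leading_of_not_vanishesBelow hq₂
    have hp₂0 : p₂.coeff 0 = 0 := by
      by_contra hne
      exact hq₂ (by simpa using hqp.of_mul hp₂ hne)
    have hq₁ne : q₁.coeff 1 ≠ 0 := by
      intro h0
      rw [h0, hp₂0] at e₁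
      norm_num at e₁
    have hp₁' : VanishesBelow (-1) p₁ := by simpa using hqp₁.of_mul hq₁1 hq₁ne
    have e := h.swap.coeff_q₁_zero (m + m)
    rw [(hqm.mul hu) (m + m) (by lia), hqm.coeff_mul_lead hqm rfl, hqm (m + m) (by lia),
      hp₁' _ (by lia), if_neg (by lia)] at e
    exact hqm0 (mul_self_eq_zero.mp (by linear_combination e))
  refine ⟨hq₁, hq₂, hp₂, ?_⟩
  have hp₁' : VanishesBelow (-1) p₁ :=
    h.swap.vanishesBelow_p₂_zero hq₂ (hq₂.mul hu) le_rfl (by lia) (by lia)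
  obtain rfl : k = -1 := by
    by_contra hne
    exact hp₁0 (hp₁' _ (by lia))
  push_cast at e₁ hu0
  -- For `k = -1` the terms in `q₁.coeff 1` cancel from `e₁`.
  have hp₂0 : p₂.coeff 0 = 1 / 4 := by linear_combination -e₁ / 4
  have e₂ := h.swap.coeff_p₁_zero 0
  rw [hp₂.coeff_mul_lead hu (j := 0) rfl, hp₂.coeff_mul_lead hq₂ (j := 0) rfl, hp₂0, hu0,
    if_pos rfl] at e₂
  have hq₂0 : q₂.coeff 0 = 1 / 2 - 2 * α₁ := by
    push_cast at e₂
    linear_combination -2 * e₂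
  have e₃ := h.swap.coeff_q₁_zero 0
  rw [hq₂.coeff_mul_lead hu (j := 0) rfl, hq₂.coeff_mul_lead hq₂ (j := 0) rfl, hu0, hq₂0] at e₃
  norm_num at e₃
  have hP : p₁.coeff (-1) = α₁ ^ 2 - 1 / 16 := by linear_combination -e₃ / 4
  simp only [formalEnergy, formalEnergyDeriv, HahnSeries.coeff_add, HahnSeries.coeff_sub,
    coeff_C_mul, coeff_lin_mul, coeff_four_mul,
    hu.coeff_mul_lead hu (j := 0) rfl, (hq₁1.mul hqp₁) 0 (by lia),
    hq₂.coeff_mul_lead (hq₂.mul hp₂) (j := 0) rfl, hq₂.coeff_mul_lead hp₂ (j := 0 + 0) rfl,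
    hp₁'.coeff_mul_lead hp₂ (j := 0 - 1) rfl, hp₂ (0 - 1) (by lia), hu0, hq₂0, hp₂0, hq₁0]
  rw [zero_sub, hP]
  ring

/-- The equation for `q₁` makes `2 u - q₁` regular, so `2 u - 2 q₁` keeps the pole of `q₁`; its
product with `p₁` is regular by the equation for `p₁`, which forces a zero of `p₁`. -/
lemma pole_q₁_zero (h : FormalSolution (lin 0) (lin 0) A α₀ α₁ q₁ p₁ q₂ p₂ u)
    (hp₁ : VanishesBelow 0 p₁) (hp₂ : VanishesBelow 0 p₂) {m : ℤ} (hm : m < 0)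
    (hq : VanishesBelow m q₁) (hq0 : q₁.coeff m ≠ 0) :
    VanishesBelow (-m) p₁ ∧ VanishesBelow m u ∧ u.coeff m = q₁.coeff m / 2 := by
  have hd : VanishesBelow 0 (2 * u - q₁) := by
    have : VanishesBelow m (q₁ * (2 * u - q₁)) := by
      intro i hi
      rw [show q₁ * (2 * u - q₁) = 2 * (q₁ * u) - q₁ * q₁ by ring, HahnSeries.coeff_sub,
        coeff_two_mul]
      have e := h.coeff_q₁_zero i
      rw [hq i hi, hp₂ (i - 1) (by lia), if_neg (by lia)] at e
      linear_combination -e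
    simpa using this.of_mul hq hq0
  have hu : ∀ i < 0, u.coeff i = q₁.coeff i / 2 := by
    intro i hi
    have := hd i hi
    rw [HahnSeries.coeff_sub, coeff_two_mul] at this
    linear_combination this / 2
  refine ⟨?_, fun i hi => by rw [hu i (by lia), hq i hi, zero_div], hu m hm⟩
  have h2 : VanishesBelow m (2 * u - 2 * q₁) := by
    rw [show 2 * u - 2 * q₁ = 2 * u - q₁ - q₁ by ring]
    exact (hd.mono hm.le).sub hq
  have h3 : (2 * u - 2 * q₁).coeff m ≠ 0 := by
    simp only [HahnSeries.coeff_sub, coeff_two_mul, hu m hm]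
    intro h0
    exact hq0 (by linear_combination -h0)
  have h4 : VanishesBelow 0 ((2 * u - 2 * q₁) * p₁) := by
    intro i hi
    rw [show (2 * u - 2 * q₁) * p₁ = 2 * (p₁ * u) - 2 * (p₁ * q₁) by ring, HahnSeries.coeff_sub,
      coeff_two_mul, coeff_two_mul]
    have e := h.coeff_p₁_zero i
    rw [hp₁ i hi, if_neg hi.ne] at e
    linear_combination e
  simpa using h4.of_mul h2 h3

/-- A pole of `q₁` is one of `u`, so `p₁ + p₂ - 1` vanishes at 0 along with `p₁`, and `p₂` equals 1
there. This passes the pole of `u` on to `q₂`, and by symmetry `p₂` vanishes at 0, a contradiction.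
-/
lemma regular_q₁_zero (h : FormalSolution (lin 0) (lin 0) A α₀ α₁ q₁ p₁ q₂ p₂ u)
    (hp₁ : VanishesBelow 0 p₁) (hp₂ : VanishesBelow 0 p₂) : VanishesBelow 0 q₁ := by
  by_contra hq
  obtain ⟨m, hm, hq, hq0⟩ := exists_leading_of_not_vanishesBelow hq
  obtain ⟨hp, hu, hu0⟩ := h.pole_q₁_zero hp₁ hp₂ hm hq hq0
  have hu0' : u.coeff m ≠ 0 := by rw [hu0]; exact div_ne_zero hq0 two_ne_zero
  have hf : VanishesBelow 0 (p₁ + p₂ - 1) := (hp₁.add hp₂).sub vanishesBelow_one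
  have hfu : VanishesBelow 0 (u * (p₁ + p₂ - 1)) := by
    have h1 := h.sum_eq
    generalize p₁ + p₂ - 1 = f at h1 hf ⊢
    intro i hi
    have e := congrArg (fun x => x.coeff i) h1
    rw [show HahnSeries.C (α₀ + α₁ - A) - f * (2 * u + HahnSeries.C A) =
      HahnSeries.C (α₀ + α₁ - A) - 2 * (u * f) - HahnSeries.C A * f by ring] at e
    simp only [HahnSeries.coeff_sub, coeff_C_mul, coeff_two_mul, coeff_lin_mul, coeff_dX, hf i hi,
      sub_add_cancel, vanishesBelow_C _ i hi] at e
    linear_combination e / 2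
  have hf0 := (hfu.of_mul hu hu0') 0 (by lia)
  rw [HahnSeries.coeff_sub, HahnSeries.coeff_add, hp 0 (by lia), HahnSeries.coeff_one] at hf0
  have hp₂0 : p₂.coeff 0 = 1 := by
    simp only [if_true] at hf0
    linear_combination hf0
  have hpq : VanishesBelow 0 (q₁ * p₁) := by simpa using hq.mul hp
  have hpq₂ : p₂ * q₂ = u - q₁ * p₁ := by rw [h.u_eq]; ring
  have hq₂ : VanishesBelow m q₂ := by
    have : VanishesBelow m (p₂ * q₂) := by
      rw [hpq₂]
      exact hu.sub (hpq.mono hm.le)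
    simpa using this.of_mul hp₂ (by rw [hp₂0]; exact one_ne_zero)
  have hq₂0 : q₂.coeff m = u.coeff m := by
    have := hp₂.coeff_mul_lead hq₂ (j := m) (by lia)
    rw [hpq₂, HahnSeries.coeff_sub, hpq m hm, hp₂0] at this
    linear_combination -this
  obtain ⟨hp', -, -⟩ := h.swap.pole_q₁_zero hp₂ hp₁ hm hq₂ (by rwa [hq₂0])
  rw [hp' 0 (by lia)] at hp₂0
  exact zero_ne_one hp₂0

/-- The case in which `p₁` and `p₂` are regular at the origin. -/
theorem regular_zero {α₃ : ℂ}
    (h : FormalSolution (lin 0) (lin 0) (α₀ + α₁ + α₃) α₀ α₁ q₁ p₁ q₂ p₂ u)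
    (hp₁ : VanishesBelow 0 p₁) (hp₂ : VanishesBelow 0 p₂) {a b c d e : ℂ}
    (ha : q₁.coeff 0 = a) (hb : p₁.coeff 0 = b) (hc : q₂.coeff 0 = c) (hd : p₂.coeff 0 = d)
    (he : (formalEnergy (lin 0) (α₀ + α₁ + α₃) α₀ α₁ q₁ p₁ q₂ p₂ u).coeff 0 = e) :
    (a = 0 ∧ -(α₀ + α₁ + α₃) * b + α₀ = 0 ∧ c = 0 ∧ -(α₀ + α₁ + α₃) * d + α₁ = 0 ∧ e = 0) ∨
     (a = 0 ∧ (-α₀ + α₁ - α₃) * b + α₀ = 0 ∧ c = α₀ - α₁ + α₃ ∧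
        (-α₀ + α₁ - α₃) * d - α₁ = 0 ∧ e = -α₁ * (α₀ + α₃)) ∨
     (a = -α₀ + α₁ + α₃ ∧ (α₀ - α₁ - α₃) * b - α₀ = 0 ∧ c = 0 ∧
        (α₀ - α₁ - α₃) * d + α₁ = 0 ∧ e = -α₀ * (α₁ + α₃)) ∨
     (a = -α₀ - α₁ + α₃ ∧ (α₀ + α₁ - α₃) * b - α₀ = 0 ∧ c = -α₀ - α₁ + α₃ ∧
        (α₀ + α₁ - α₃) * d - α₁ = 0 ∧ e = -α₃ * (α₀ + α₁)) := by
  have hq₁ := h.regular_q₁_zero hp₁ hp₂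
  have hq₂ := h.swap.regular_q₁_zero hp₂ hp₁
  have hu : VanishesBelow 0 u := by
    rw [h.u_eq]
    exact (hq₁.mul hp₁).add (hq₂.mul hp₂)
  have e₀ := h.coeff_u 0
  rw [hq₁.coeff_mul_lead hp₁ (j := 0) rfl, hq₂.coeff_mul_lead hp₂ (j := 0) rfl, ha, hb, hc, hd]
    at e₀
  have e₁ := h.coeff_q₁_zero 0
  rw [hq₁.coeff_mul_lead hu (j := 0) rfl, hq₁.coeff_mul_lead hq₁ (j := 0) rfl,
    hp₂ (0 - 1) (by lia), ha] at e₁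
  have e₂ := h.swap.coeff_q₁_zero 0
  rw [hq₂.coeff_mul_lead hu (j := 0) rfl, hq₂.coeff_mul_lead hq₂ (j := 0) rfl,
    hp₁ (0 - 1) (by lia), hc] at e₂
  have e₃ := h.coeff_p₁_zero 0
  rw [hp₁.coeff_mul_lead hu (j := 0) rfl, hp₁.coeff_mul_lead hq₁ (j := 0) rfl, if_pos rfl,
    ha, hb] at e₃
  have e₄ := h.swap.coeff_p₁_zero 0
  rw [hp₂.coeff_mul_lead hu (j := 0) rfl, hp₂.coeff_mul_lead hq₂ (j := 0) rfl, if_pos rfl,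
    hc, hd] at e₄
  simp only [formalEnergy, formalEnergyDeriv, HahnSeries.coeff_add, HahnSeries.coeff_sub,
    coeff_C_mul, coeff_lin_mul, coeff_four_mul, hu.coeff_mul_lead hu (j := 0) rfl,
    hq₁.coeff_mul_lead (hq₁.mul hp₁) (j := 0) rfl, hq₁.coeff_mul_lead hp₁ (j := 0 + 0) rfl,
    hq₂.coeff_mul_lead (hq₂.mul hp₂) (j := 0) rfl, hq₂.coeff_mul_lead hp₂ (j := 0 + 0) rfl,
    (hp₁.mul hp₂) (0 - 1) (by lia), hp₁ (0 - 1) (by lia), hp₂ (0 - 1) (by lia),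
    ha, hb, hc, hd] at he
  generalize u.coeff 0 = v at *
  norm_num at e₁ e₂ e₃ e₄ he
  have e₁' : a * (2 * v - a + (α₀ + α₁ + α₃)) = 0 := by linear_combination -e₁
  have e₂' : c * (2 * v - c + (α₀ + α₁ + α₃)) = 0 := by linear_combination -e₂
  -- The four choices of factors are the four cases. When `2 v - a + A = 0`, the equation for `p₁`
  -- reduces to `a b = -α₀`; similarly `c d = -α₁`. This determines `v = a b + c d`.
  rcases mul_eq_zero.mp e₁' with ha | ha <;> rcases mul_eq_zero.mp e₂' with hc | hc
  · subst ha hc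
    have hv : v = 0 := by linear_combination e₀
    subst hv
    exact Or.inl ⟨rfl, by linear_combination -e₃, rfl, by linear_combination -e₄,
      by linear_combination -he⟩
  · subst ha
    have hv : v = -α₁ := by linear_combination e₀ - e₄ + d * hc
    subst hv
    obtain rfl : c = α₀ - α₁ + α₃ := by linear_combination -hc
    refine Or.inr (Or.inl ⟨rfl, by linear_combination -e₃, rfl, by linear_combination e₀, ?_⟩)
    linear_combination -he + (α₀ - α₁ + α₃) * e₀
  · subst hc
    have hv : v = -α₀ := by linear_combination e₀ - e₃ + b * ha
    subst hv
    obtain rfl : a = -α₀ + α₁ + α₃ := by linear_combination -ha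
    refine Or.inr (Or.inr (Or.inl ⟨rfl, by linear_combination e₀, rfl,
      by linear_combination -e₄, ?_⟩))
    linear_combination -he + (-α₀ + α₁ + α₃) * e₀
  · have hv : v = -α₀ - α₁ := by linear_combination e₀ - e₃ + b * ha - e₄ + d * hc
    subst hv
    obtain rfl : a = -α₀ - α₁ + α₃ := by linear_combination -ha
    obtain rfl : c = -α₀ - α₁ + α₃ := by linear_combination -hc
    refine Or.inr (Or.inr (Or.inr ⟨rfl, by linear_combination e₃, rfl,
      by linear_combination e₄, ?_⟩))
    linear_combination -he + (-α₀ - α₁ + α₃) * e₀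

end FormalSolution
/-! ### Formal solutions at infinity -/

/-- The multiplier of the formal derivative in the coordinate `1 / t`. -/
noncomputable def eulerInf : LaurentSeries ℂ := HahnSeries.single 1 (-1)

/-- The expansion of `t` in the coordinate `1 / t`. -/
noncomputable def linInf : LaurentSeries ℂ := HahnSeries.single (-1) 1

lemma coeff_euler_infinity (y : LaurentSeries ℂ) (n : ℤ) :
    (eulerInf * dX y).coeff n = -1 * n * y.coeff n := by
  rw [eulerInf, HahnSeries.coeff_single_mul, coeff_dX, sub_add_cancel]
  push_cast
  ring

lemma coeff_linInf_mul (y : LaurentSeries ℂ) (n : ℤ) :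
    (linInf * y).coeff n = y.coeff (n + 1) := by
  simp [linInf, HahnSeries.coeff_single_mul]

lemma coeff_linInf (n : ℤ) : linInf.coeff n = if n = -1 then 1 else 0 := by
  rw [linInf, HahnSeries.coeff_single]; congr

namespace FormalSolution

variable {A α₀ α₁ : ℂ} {q₁ p₁ q₂ p₂ u : LaurentSeries ℂ}

lemma coeff_q₁_infinity (h : FormalSolution eulerInf linInf A α₀ α₁ q₁ p₁ q₂ p₂ u) (n : ℤ) :
    -n * q₁.coeff n = 2 * (q₁ * u).coeff n - (q₁ * q₁).coeff n + A * q₁.coeff n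
        - (if n = -1 then 1 else 0) + 4 * p₂.coeff (n + 1) := by
  have e := congrArg (fun x => x.coeff n) h.q₁_eq
  simp only [HahnSeries.coeff_add, HahnSeries.coeff_sub, coeff_C_mul, coeff_two_mul,
    coeff_four_mul, coeff_linInf, coeff_linInf_mul, coeff_euler_infinity] at e
  linear_combination e

lemma coeff_p₁_infinity (h : FormalSolution eulerInf linInf A α₀ α₁ q₁ p₁ q₂ p₂ u) (n : ℤ) :
    -n * p₁.coeff n = (if n = 0 then α₀ else 0) - 2 * (p₁ * u).coeff n + 2 * (p₁ * q₁).coeff n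
      - A * p₁.coeff n := by
  have e := congrArg (fun x => x.coeff n) h.p₁_eq
  rw [show HahnSeries.C α₀ - p₁ * (2 * u - 2 * q₁ + HahnSeries.C A) =
    HahnSeries.C α₀ - 2 * (p₁ * u) + 2 * (p₁ * q₁) - HahnSeries.C A * p₁ by ring] at e
  simp only [HahnSeries.coeff_add, HahnSeries.coeff_sub, coeff_C_mul, coeff_two_mul, coeff_C,
    coeff_euler_infinity] at e
  linear_combination e

lemma coeff_u_infinity (h : FormalSolution eulerInf linInf A α₀ α₁ q₁ p₁ q₂ p₂ u) (n : ℤ) :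
    u.coeff n = (q₁ * p₁).coeff n + (q₂ * p₂).coeff n := by
  rw [h.u_eq, HahnSeries.coeff_add]

lemma regular_sub_infinity (h : FormalSolution eulerInf linInf A α₀ α₁ q₁ p₁ q₂ p₂ u) {m : ℤ}
    (hm : m ≤ 0) (hp : VanishesBelow m p₁) (h0 : p₁.coeff m ≠ 0) : VanishesBelow 0 (u - q₁) := by
  obtain ⟨h1, -⟩ := regular_of_linear (coeff_euler_infinity _) hm hp h0 h.p₁_eq
  intro i hi
  have := h1 i hi
  simp only [HahnSeries.coeff_add, HahnSeries.coeff_sub, coeff_two_mul, coeff_C,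
    if_neg hi.ne] at this
  rw [HahnSeries.coeff_sub]
  linear_combination this / 2

lemma regular_u_infinity (h : FormalSolution eulerInf linInf A α₀ α₁ q₁ p₁ q₂ p₂ u) {m : ℤ}
    (hm : m ≤ 0) (hf : VanishesBelow m (p₁ + p₂ - 1)) (h0 : (p₁ + p₂ - 1).coeff m ≠ 0) :
    VanishesBelow 0 u := by
  obtain ⟨h1, -⟩ := regular_of_linear (coeff_euler_infinity _) hm hf h0 h.sum_eq
  intro i hi
  have := h1 i hi
  simp only [HahnSeries.coeff_add, coeff_two_mul, coeff_C, if_neg hi.ne] at this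
  linear_combination this / 2

/-- Here `T` has a simple pole, so `p₂` gains one order; `n ≤ -1` keeps the inhomogeneous term `-T`
out of range. -/
lemma vanishesBelow_p₂_infinity (h : FormalSolution eulerInf linInf A α₀ α₁ q₁ p₁ q₂ p₂ u)
    {m n : ℤ} (hq : VanishesBelow m q₁) (hqu : VanishesBelow n (q₁ * u)) (hn : n ≤ -1)
    (h1 : n ≤ m + m) : VanishesBelow (n + 1) p₂ := by
  intro i hi
  have e := h.coeff_q₁_infinity (i - 1)
  rw [hqu _ (by lia), (hq.mul hq) _ (by lia), hq _ (by lia), if_neg (by lia),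
    sub_add_cancel] at e
  linear_combination -e / 4

lemma not_both_poles_infinity (h : FormalSolution eulerInf linInf A α₀ α₁ q₁ p₁ q₂ p₂ u)
    (h₁ : ¬ VanishesBelow 0 p₁) (h₂ : ¬ VanishesBelow 0 p₂) : False := by
  obtain ⟨k, hk, hp₁, hp₁0⟩ := exists_leading_of_not_vanishesBelow h₁
  obtain ⟨l, hl, hp₂, hp₂0⟩ := exists_leading_of_not_vanishesBelow h₂
  have hd₁ := h.regular_sub_infinity hk.le hp₁ hp₁0
  have hd₂ := h.swap.regular_sub_infinity hl.le hp₂ hp₂0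
  have hq₁ : VanishesBelow 0 q₁ := by
    by_contra hq
    obtain ⟨m, hm, hqm, hq0⟩ := exists_leading_of_not_vanishesBelow hq
    have hum : VanishesBelow m u := by simpa using (hd₁.mono hm.le).add hqm
    have hqm₂ : VanishesBelow m q₂ := by simpa using hum.sub (hd₂.mono hm.le)
    have hu0 : u.coeff m = q₁.coeff m := coeff_eq_of_vanishesBelow_sub hd₁ hm
    have hq₂0 : q₂.coeff m = q₁.coeff m := by
      rw [← hu0, coeff_eq_of_vanishesBelow_sub hd₂ hm]
    have hp₂ : VanishesBelow (m + m + 1) p₂ :=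
      h.vanishesBelow_p₂_infinity hqm (hqm.mul hum) (by lia) le_rfl
    have hp₁ : VanishesBelow (m + m + 1) p₁ :=
      h.swap.vanishesBelow_p₂_infinity hqm₂ (hqm₂.mul hum) (by lia) le_rfl
    have e₂ := h.coeff_q₁_infinity (m + m)
    rw [hqm.coeff_mul_lead hum rfl, hqm.coeff_mul_lead hqm rfl, hqm (m + m) (by lia), hu0,
      if_neg (by lia)] at e₂
    have e₁ := h.swap.coeff_q₁_infinity (m + m)
    rw [hqm₂.coeff_mul_lead hum rfl, hqm₂.coeff_mul_lead hqm₂ rfl, hqm₂ (m + m) (by lia), hu0,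
      hq₂0, if_neg (by lia)] at e₁
    have e := h.coeff_u_infinity (m + (m + m + 1))
    rw [hqm.coeff_mul_lead hp₁ rfl, hqm₂.coeff_mul_lead hp₂ rfl, hum _ (by lia), hq₂0] at e
    have : q₁.coeff m ^ 3 = 0 := by
      linear_combination 2 * e - q₁.coeff m * e₁ / 2 - q₁.coeff m * e₂ / 2
    exact hq0 (by simpa using this)
  have hu : VanishesBelow 0 u := by simpa using hd₁.add hq₁
  exact h₂ (h.vanishesBelow_p₂_infinity (n := -1) hq₁ ((hq₁.mul hu).mono (by lia)) le_rfl
    (by lia))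

/-- With `q₁` and `u` regular, `-T + 4 T p₂` must have no pole. -/
lemma coeff_p₂_infinity (h : FormalSolution eulerInf linInf A α₀ α₁ q₁ p₁ q₂ p₂ u)
    (hq₁ : VanishesBelow 0 q₁) (hu : VanishesBelow 0 u) : p₂.coeff 0 = 1 / 4 := by
  have e := h.coeff_q₁_infinity (-1)
  rw [(hq₁.mul hu) (-1) (by lia), (hq₁.mul hq₁) (-1) (by lia), hq₁ (-1) (by lia),
    if_pos rfl] at e
  norm_num at e
  linear_combination -e / 4

/-- If only `p₁` had a pole, `u` and `u - q₁` would be regular, hence `p₂` would be `1/4` at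
infinity. Being nonzero, this makes `q₂` regular too, and the equation for `q₂` then makes `p₁`
regular. -/
lemma regular_p₁_infinity (h : FormalSolution eulerInf linInf A α₀ α₁ q₁ p₁ q₂ p₂ u) :
    VanishesBelow 0 p₁ := by
  by_contra h₁
  have hp₂ : VanishesBelow 0 p₂ := by
    by_contra h₂
    exact h.not_both_poles_infinity h₁ h₂
  obtain ⟨k, hk, hp₁, hp₁0⟩ := exists_leading_of_not_vanishesBelow h₁
  have hd := h.regular_sub_infinity hk.le hp₁ hp₁0
  have hf : VanishesBelow k (p₁ + p₂ - 1) :=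
    (hp₁.add (hp₂.mono (by lia))).sub (vanishesBelow_one.mono (by lia))
  have hf0 : (p₁ + p₂ - 1).coeff k ≠ 0 := by
    rw [HahnSeries.coeff_sub, HahnSeries.coeff_add, hp₂ k hk, vanishesBelow_one k hk]
    simpa using hp₁0
  have hu := h.regular_u_infinity hk.le hf hf0
  have hq₁ : VanishesBelow 0 q₁ := by simpa using hu.sub hd
  have hp₂0 := h.coeff_p₂_infinity hq₁ hu
  have hd₂ := h.swap.regular_sub_infinity le_rfl hp₂ (by rw [hp₂0]; norm_num)
  have hq₂ : VanishesBelow 0 q₂ := by simpa using hu.sub hd₂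
  exact h₁ (h.swap.vanishesBelow_p₂_infinity (n := -1) hq₂ ((hq₂.mul hu).mono (by lia)) le_rfl
    (by lia))

/-- Since `u - q₁` is regular, a pole of `q₁` would leave `2 q₁ u - q₁²` with the nonzero leading
term of `q₁²`, which nothing else balances. -/
lemma regular_infinity_of_coeff_ne_zero
    (h : FormalSolution eulerInf linInf A α₀ α₁ q₁ p₁ q₂ p₂ u) (hp : p₁.coeff 0 ≠ 0) :
    VanishesBelow 0 u ∧ VanishesBelow 0 q₁ ∧ p₂.coeff 0 = 1 / 4 := by
  have hp₂ := h.swap.regular_p₁_infinity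
  have hd := h.regular_sub_infinity le_rfl h.regular_p₁_infinity hp
  have hq₁ : VanishesBelow 0 q₁ := by
    by_contra hq
    obtain ⟨m, hm, hqm, hq0⟩ := exists_leading_of_not_vanishesBelow hq
    have hum : VanishesBelow m u := by simpa using (hd.mono hm.le).add hqm
    have hu0 : u.coeff m = q₁.coeff m := coeff_eq_of_vanishesBelow_sub hd hm
    have e := h.coeff_q₁_infinity (m + m)
    rw [hqm.coeff_mul_lead hum rfl, hqm.coeff_mul_lead hqm rfl, hqm (m + m) (by lia), hu0,
      hp₂ _ (by lia), if_neg (by lia)] at e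
    exact hq0 (mul_self_eq_zero.mp (by linear_combination -e))
  have hu : VanishesBelow 0 u := by simpa using hd.add hq₁
  exact ⟨hu, hq₁, h.coeff_p₂_infinity hq₁ hu⟩

/-- If both `p`s vanish at infinity, `p₁ + p₂ - 1` does not, so `u` and then `q₂` are regular. In
every case `p₁` would be `1/4` after all. -/
lemma coeff_p₁_infinity_ne_zero
    (h : FormalSolution eulerInf linInf A α₀ α₁ q₁ p₁ q₂ p₂ u) : p₁.coeff 0 ≠ 0 := by
  intro hp₁0
  have hp₁ := h.regular_p₁_infinity
  have hp₂ := h.swap.regular_p₁_infinity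
  by_cases hp₂0 : p₂.coeff 0 = 0
  · have hu := h.regular_u_infinity le_rfl ((hp₁.add hp₂).sub vanishesBelow_one) (by
      rw [HahnSeries.coeff_sub, HahnSeries.coeff_add, hp₁0, hp₂0, HahnSeries.coeff_one]
      simp)
    have hq₂ : VanishesBelow 0 q₂ := by
      by_contra hq
      obtain ⟨m, hm, hqm, hq0⟩ := exists_leading_of_not_vanishesBelow hq
      have e := h.swap.coeff_q₁_infinity (m + m)
      rw [(hqm.mul hu) (m + m) (by lia), hqm.coeff_mul_lead hqm rfl, hqm (m + m) (by lia),
        hp₁ _ (by lia), if_neg (by lia)] at e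
      exact hq0 (mul_self_eq_zero.mp (by linear_combination e))
    have := h.swap.coeff_p₂_infinity hq₂ hu
    rw [hp₁0] at this
    norm_num at this
  · have := (h.swap.regular_infinity_of_coeff_ne_zero hp₂0).2.2
    rw [hp₁0] at this
    norm_num at this

/-- The constant term of the Hamiltonian at infinity. -/
theorem energy_infinity {α₃ : ℂ}
    (h : FormalSolution eulerInf linInf (α₀ + α₁ + α₃) α₀ α₁ q₁ p₁ q₂ p₂ u) :
    (formalEnergy linInf (α₀ + α₁ + α₃) α₀ α₁ q₁ p₁ q₂ p₂ u).coeff 0 = hInfinity α₀ α₁ α₃ := by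
  have hp₁ := h.regular_p₁_infinity
  have hp₂ := h.swap.regular_p₁_infinity
  obtain ⟨hu, hq₁, hp₂0⟩ := h.regular_infinity_of_coeff_ne_zero h.coeff_p₁_infinity_ne_zero
  obtain ⟨-, hq₂, hp₁0⟩ :=
    h.swap.regular_infinity_of_coeff_ne_zero h.swap.coeff_p₁_infinity_ne_zero
  have e₀ := h.coeff_u_infinity 0
  rw [hq₁.coeff_mul_lead hp₁ (j := 0) rfl, hq₂.coeff_mul_lead hp₂ (j := 0) rfl, hp₁0, hp₂0] at e₀
  have e₁ := h.coeff_p₁_infinity 0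
  rw [hp₁.coeff_mul_lead hu (j := 0) rfl, hp₁.coeff_mul_lead hq₁ (j := 0) rfl, if_pos rfl,
    hp₁0] at e₁
  have e₂ := h.swap.coeff_p₁_infinity 0
  rw [hp₂.coeff_mul_lead hu (j := 0) rfl, hp₂.coeff_mul_lead hq₂ (j := 0) rfl, if_pos rfl,
    hp₂0] at e₂
  norm_num at e₁ e₂
  have hv : u.coeff 0 = (α₃ - α₀ - α₁) / 2 := by linear_combination 2 * e₀ - e₁ - e₂
  have ha : q₁.coeff 0 = α₃ - 2 * α₀ := by linear_combination hv - 2 * e₁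
  have hc : q₂.coeff 0 = α₃ - 2 * α₁ := by linear_combination hv - 2 * e₂
  -- Both `p`s being `1/4` at infinity, the coefficient of order 1 of `4 p₁ p₂ - p₁ - p₂` cancels,
  -- so the term with `T` adds nothing.
  simp only [formalEnergy, formalEnergyDeriv, HahnSeries.coeff_add, HahnSeries.coeff_sub,
    coeff_C_mul, coeff_linInf_mul, coeff_four_mul, hu.coeff_mul_lead hu (j := 0) rfl,
    hq₁.coeff_mul_lead (hq₁.mul hp₁) (j := 0) rfl, hq₁.coeff_mul_lead hp₁ (j := 0 + 0) rfl,
    hq₂.coeff_mul_lead (hq₂.mul hp₂) (j := 0) rfl, hq₂.coeff_mul_lead hp₂ (j := 0 + 0) rfl,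
    hp₁.coeff_mul_next hp₂ (j := 0 + 1) rfl, hp₁0, hp₂0, ha, hc, hv, hInfinity]
  ring

end FormalSolution
/-! ### From meromorphic functions to formal solutions -/

/-- The two roles of `t` are separated: `σ` multiplies the derivative and `τ` stands for `t` itself.
At infinity, with `w = 1/t`, they are `-w` and `1/w`. -/
lemma formalSolution_of_eventually {A α₀ α₁ c : ℂ} {σ τ q₁ p₁ q₂ p₂ : ℂ → ℂ}
    {S T a₁ b₁ a₂ b₂ : LaurentSeries ℂ} (hσ : Expansion σ c S) (hτ : Expansion τ c T)
    (hq₁ : Expansion q₁ c a₁) (hp₁ : Expansion p₁ c b₁) (hq₂ : Expansion q₂ c a₂)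
    (hp₂ : Expansion p₂ c b₂)
    (h : ∀ᶠ z in 𝓝[≠] c,
      σ z * deriv q₁ z = 2 * q₁ z ^ 2 * p₁ z - q₁ z ^ 2 + A * q₁ z - τ z + 4 * τ z * p₂ z
        + 2 * q₁ z * q₂ z * p₂ z ∧
      σ z * deriv p₁ z = -2 * q₁ z * p₁ z ^ 2 + 2 * q₁ z * p₁ z - A * p₁ z + α₀
        - 2 * p₁ z * q₂ z * p₂ z ∧
      σ z * deriv q₂ z = 2 * q₂ z ^ 2 * p₂ z - q₂ z ^ 2 + A * q₂ z - τ z + 4 * τ z * p₁ z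
        + 2 * q₁ z * p₁ z * q₂ z ∧
      σ z * deriv p₂ z = -2 * q₂ z * p₂ z ^ 2 + 2 * q₂ z * p₂ z - A * p₂ z + α₁
        - 2 * q₁ z * p₁ z * p₂ z) :
    FormalSolution S T A α₀ α₁ a₁ b₁ a₂ b₂ (a₁ * b₁ + a₂ * b₂) := by
  have hu := (hq₁.mul hp₁).add (hq₂.mul hp₂)
  refine ⟨rfl, ?_, ?_, ?_, ?_⟩
  · refine (hσ.mul hq₁.deriv).unique (((((hq₁.mul hu).ofNat_mul 2).sub (hq₁.mul hq₁)).add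
      (hq₁.const_mul A)).sub hτ |>.add ((hτ.mul hp₂).ofNat_mul 4)) ?_
    filter_upwards [h] with z hz
    linear_combination hz.1
  · refine (hσ.mul hp₁.deriv).unique ((Expansion.const α₀).sub (hp₁.mul
      (((hu.ofNat_mul 2).sub (hq₁.ofNat_mul 2)).add (Expansion.const A)))) ?_
    filter_upwards [h] with z hz
    linear_combination hz.2.1
  · refine (hσ.mul hq₂.deriv).unique (((((hq₂.mul hu).ofNat_mul 2).sub (hq₂.mul hq₂)).add
      (hq₂.const_mul A)).sub hτ |>.add ((hτ.mul hp₁).ofNat_mul 4)) ?_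
    filter_upwards [h] with z hz
    linear_combination hz.2.2.1
  · refine (hσ.mul hp₂.deriv).unique ((Expansion.const α₁).sub (hp₂.mul
      (((hu.ofNat_mul 2).sub (hq₂.ofNat_mul 2)).add (Expansion.const A)))) ?_
    filter_upwards [h] with z hz
    linear_combination hz.2.2.2

lemma expansion_energy {A α₀ α₁ c : ℂ} {τ q₁ p₁ q₂ p₂ : ℂ → ℂ}
    {T a₁ b₁ a₂ b₂ : LaurentSeries ℂ} (hτ : Expansion τ c T)
    (hq₁ : Expansion q₁ c a₁) (hp₁ : Expansion p₁ c b₁) (hq₂ : Expansion q₂ c a₂)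
    (hp₂ : Expansion p₂ c b₂) :
    Expansion (fun t => q₁ t ^ 2 * p₁ t ^ 2 - q₁ t ^ 2 * p₁ t + A * q₁ t * p₁ t - α₀ * q₁ t
      - τ t * p₁ t + q₂ t ^ 2 * p₂ t ^ 2 - q₂ t ^ 2 * p₂ t + A * q₂ t * p₂ t - α₁ * q₂ t
      - τ t * p₂ t + 4 * τ t * p₁ t * p₂ t + 2 * q₁ t * p₁ t * q₂ t * p₂ t) c
      (formalEnergy T A α₀ α₁ a₁ b₁ a₂ b₂ (a₁ * b₁ + a₂ * b₂)) := by
  have hu := (hq₁.mul hp₁).add (hq₂.mul hp₂)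
  refine (((((((hu.mul hu).sub (hq₁.mul (hq₁.mul hp₁))).sub (hq₂.mul (hq₂.mul hp₂))).add
    (hu.const_mul A)).sub (hq₁.const_mul α₀)).sub (hq₂.const_mul α₁)).add
    (hτ.mul ((((hp₁.mul hp₂).ofNat_mul 4).sub hp₁).sub hp₂))).congr ?_
  filter_upwards with z
  ring

variable {α₀ α₁ α₃ : ℂ} {q₁ p₁ q₂ p₂ : ℂ → ℂ}

lemma deriv_hamiltonian {t : ℂ} (ht : t ≠ 0) (hq₁ : DifferentiableAt ℂ q₁ t)
    (hp₁ : DifferentiableAt ℂ p₁ t) (hq₂ : DifferentiableAt ℂ q₂ t)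
    (hp₂ : DifferentiableAt ℂ p₂ t) (h : SystemAt α₀ α₁ α₃ q₁ p₁ q₂ p₂ t) :
    deriv (hamiltonian α₀ α₁ α₃ q₁ p₁ q₂ p₂) t = 4 * (p₁ t * p₂ t) - p₁ t - p₂ t := by
  obtain ⟨h₁, h₂, h₃, h₄⟩ := h
  have d₁ := hq₁.hasDerivAt
  have d₂ := hp₁.hasDerivAt
  have d₃ := hq₂.hasDerivAt
  have d₄ := hp₂.hasDerivAt
  have d := (((((((((((d₁.fun_pow 2).fun_mul (d₂.fun_pow 2)).fun_sub
    ((d₁.fun_pow 2).fun_mul d₂)).fun_add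
    ((d₁.const_mul (α₀ + α₁ + α₃)).fun_mul d₂)).fun_sub (d₁.const_mul α₀)).fun_sub
    ((hasDerivAt_id' t).fun_mul d₂)).fun_add ((d₃.fun_pow 2).fun_mul (d₄.fun_pow 2))).fun_sub
    ((d₃.fun_pow 2).fun_mul d₄)).fun_add
    ((d₃.const_mul (α₀ + α₁ + α₃)).fun_mul d₄)).fun_sub (d₃.const_mul α₁)).fun_sub
    ((hasDerivAt_id' t).fun_mul d₄)).fun_add
    ((((hasDerivAt_id' t).const_mul 4).fun_mul d₂).fun_mul d₄) |>.fun_add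
    ((((d₁.const_mul 2).fun_mul d₂).fun_mul d₃).fun_mul d₄)
  have e : deriv (hamiltonian α₀ α₁ α₃ q₁ p₁ q₂ p₂) t = _ := d.deriv
  rw [e]
  apply mul_left_cancel₀ ht
  push_cast
  simp only [pow_one]
  generalize deriv q₁ t = x₁ at *
  generalize deriv p₁ t = y₁ at *
  generalize deriv q₂ t = x₂ at *
  generalize deriv p₂ t = y₂ at *
  generalize q₁ t = q₁ at *
  generalize p₁ t = p₁ at *
  generalize q₂ t = q₂ at *
  generalize p₂ t = p₂ at *
  -- The multipliers are the partial derivatives of `H` in `q₁`, `p₁`, `q₂`, `p₂`; by Hamilton's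
  -- equations these contributions cancel, leaving the explicit `t`-derivative.
  linear_combination
    (2 * q₁ * p₁ ^ 2 - 2 * q₁ * p₁ + (α₀ + α₁ + α₃) * p₁ - α₀ + 2 * p₁ * q₂ * p₂) * h₁ +
    (2 * q₁ ^ 2 * p₁ - q₁ ^ 2 + (α₀ + α₁ + α₃) * q₁ - t + 4 * t * p₂ + 2 * q₁ * q₂ * p₂) * h₂ +
    (2 * q₂ * p₂ ^ 2 - 2 * q₂ * p₂ + (α₀ + α₁ + α₃) * p₂ - α₁ + 2 * q₁ * p₁ * p₂) * h₃ +
    (2 * q₂ ^ 2 * p₂ - q₂ ^ 2 + (α₀ + α₁ + α₃) * q₂ - t + 4 * t * p₁ + 2 * q₁ * p₁ * q₂) * h₄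

lemma expansion_hamiltonian {c : ℂ} {a₁ b₁ a₂ b₂ : LaurentSeries ℂ}
    (hq₁ : Expansion q₁ c a₁) (hp₁ : Expansion p₁ c b₁) (hq₂ : Expansion q₂ c a₂)
    (hp₂ : Expansion p₂ c b₂) :
    Expansion (hamiltonian α₀ α₁ α₃ q₁ p₁ q₂ p₂) c
      (formalEnergy (lin c) (α₀ + α₁ + α₃) α₀ α₁ a₁ b₁ a₂ b₂ (a₁ * b₁ + a₂ * b₂)) :=
  expansion_energy (expansion_id c) hq₁ hp₁ hq₂ hp₂

/-- Along a meromorphic solution, the Hamiltonian has at most a simple pole at `c ≠ 0`, with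
residue a multiple of `c / 4`. -/
theorem exists_expansion_hamiltonian {c : ℂ} (hc : c ≠ 0)
    (h : IsMeromorphicSolutionAt α₀ α₁ α₃ q₁ p₁ q₂ p₂ c) :
    ∃ a, Expansion (hamiltonian α₀ α₁ α₃ q₁ p₁ q₂ p₂) c a ∧ VanishesBelow (-1) a ∧
      ∃ n : ℤ, a.coeff (-1) = n * (c / 4) := by
  obtain ⟨hq₁, hp₁, hq₂, hp₂, h⟩ := h
  obtain ⟨a₁, hq₁⟩ := exists_expansion hq₁
  obtain ⟨b₁, hp₁⟩ := exists_expansion hp₁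
  obtain ⟨a₂, hq₂⟩ := exists_expansion hq₂
  obtain ⟨b₂, hp₂⟩ := exists_expansion hp₂
  have hsol : FormalSolution (lin c) (lin c) (α₀ + α₁ + α₃) α₀ α₁ a₁ b₁ a₂ b₂ _ :=
    formalSolution_of_eventually (expansion_id c) (expansion_id c) hq₁ hp₁ hq₂ hp₂ h
  have hH := expansion_hamiltonian (α₀ := α₀) (α₁ := α₁) (α₃ := α₃) hq₁ hp₁ hq₂ hp₂
  refine ⟨_, hH, ?_⟩
  have hd : dX (formalEnergy (lin c) (α₀ + α₁ + α₃) α₀ α₁ a₁ b₁ a₂ b₂ (a₁ * b₁ + a₂ * b₂)) =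
      formalEnergyDeriv b₁ b₂ := by
    refine hH.deriv.unique ((((hp₁.mul hp₂).ofNat_mul 4).sub hp₁).sub hp₂) ?_
    have hne : ∀ᶠ z in 𝓝[≠] c, z ≠ 0 :=
      (continuousAt_id.eventually_ne hc).filter_mono nhdsWithin_le_nhds
    filter_upwards [h, hne, hq₁.eventually_differentiableAt, hp₁.eventually_differentiableAt,
      hq₂.eventually_differentiableAt, hp₂.eventually_differentiableAt] with z h h0 h₁ h₂ h₃ h₄
    exact deriv_hamiltonian h0 h₁ h₂ h₃ h₄ h
  obtain ⟨h1, n, h2⟩ := hsol.energy hc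
  rw [← hd] at h1 h2
  constructor
  -- Coefficient `i - 1` of the derivative is `i` times coefficient `i`, with `i ≠ 0`; at `i = -1`
  -- this gives the sign of the residue.
  · intro i hi
    have := h1 (i - 1) (by lia)
    rw [coeff_dX, sub_add_cancel] at this
    refine (mul_eq_zero.mp this).resolve_left ?_
    push_cast
    rw [sub_add_cancel]
    exact_mod_cast (show i ≠ 0 by lia)
  · refine ⟨-n, ?_⟩
    rw [coeff_dX] at h2
    norm_num at h2
    push_cast
    linear_combination -h2

/-! ### Rational functions -/

lemma expansion_polynomial (N : Polynomial ℂ) (c : ℂ) :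
    ∃ a, Expansion (fun z => N.eval z) c a ∧ VanishesBelow 0 a ∧ a.coeff 0 = N.eval c := by
  refine ⟨_, Expansion.of_analyticAt (f := fun z => N.eval z) (c := c) ?_,
    vanishesBelow_ofPowerSeries _, ?_⟩
  · exact AnalyticOnNhd.eval_polynomial N c trivial
  · simpa [taylor] using LaurentSeries.coeff_coe_powerSeries (taylor (fun z => N.eval z) c) 0

lemma meromorphicAt_polynomial_inv (N : Polynomial ℂ) : MeromorphicAt (fun w => N.eval w⁻¹) 0 := by
  induction N using Polynomial.induction_on' with
  | add p q hp hq => simpa using hp.fun_add hq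
  | monomial n a =>
    simp only [Polynomial.eval_monomial]
    exact (MeromorphicAt.const a 0).fun_mul ((MeromorphicAt.id 0).fun_inv.fun_pow n)

lemma toFun_eq (r : RatFunc ℂ) (t : ℂ) : toFun r t = r.num.eval t / r.denom.eval t := by
  simp [toFun, RatFunc.eval, Polynomial.eval₂_id]

lemma meromorphicAt_toFun (r : RatFunc ℂ) (c : ℂ) : MeromorphicAt (toFun r) c := by
  rw [show toFun r = fun t => r.num.eval t / r.denom.eval t from funext (toFun_eq r)]
  exact (AnalyticOnNhd.eval_polynomial _ c trivial).meromorphicAt.fun_div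
    (AnalyticOnNhd.eval_polynomial _ c trivial).meromorphicAt

lemma meromorphicAt_toFun_inv (r : RatFunc ℂ) : MeromorphicAt (fun w => toFun r w⁻¹) 0 := by
  simp only [toFun_eq]
  exact (meromorphicAt_polynomial_inv _).fun_div (meromorphicAt_polynomial_inv _)

lemma eventually_eval_ne_zero {D : Polynomial ℂ} (hD : D ≠ 0) :
    ∀ᶠ t in cofinite, D.eval t ≠ 0 := by
  refine (D.roots.toFinset.finite_toSet).subset fun t ht => ?_
  simpa [hD] using ht

/-- `f` agrees with a quotient of two polynomials off finitely many points. -/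
def IsRational (f : ℂ → ℂ) : Prop :=
  ∃ N D : Polynomial ℂ, D ≠ 0 ∧ ∀ᶠ t in cofinite, D.eval t * f t = N.eval t

namespace IsRational

variable {f g : ℂ → ℂ}

lemma polynomial (N : Polynomial ℂ) : IsRational fun t => N.eval t :=
  ⟨N, 1, one_ne_zero, by simp⟩

lemma const (r : ℂ) : IsRational fun _ => r := by
  simpa using polynomial (Polynomial.C r)

lemma id : IsRational fun t => t := by
  simpa using polynomial Polynomial.X

lemma add (hf : IsRational f) (hg : IsRational g) : IsRational fun t => f t + g t := by
  obtain ⟨N, D, hD, hf⟩ := hf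
  obtain ⟨M, E, hE, hg⟩ := hg
  refine ⟨E * N + D * M, D * E, mul_ne_zero hD hE, ?_⟩
  filter_upwards [hf, hg] with t h₁ h₂
  simp only [Polynomial.eval_mul, Polynomial.eval_add]
  linear_combination E.eval t * h₁ + D.eval t * h₂

lemma mul (hf : IsRational f) (hg : IsRational g) : IsRational fun t => f t * g t := by
  obtain ⟨N, D, hD, hf⟩ := hf
  obtain ⟨M, E, hE, hg⟩ := hg
  refine ⟨N * M, D * E, mul_ne_zero hD hE, ?_⟩
  filter_upwards [hf, hg] with t h₁ h₂
  simp only [Polynomial.eval_mul, ← h₁, ← h₂]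
  ring

lemma sub (hf : IsRational f) (hg : IsRational g) : IsRational fun t => f t - g t := by
  simpa [sub_eq_add_neg] using hf.add ((const (-1)).mul hg)

lemma pow (hf : IsRational f) (n : ℕ) : IsRational fun t => f t ^ n := by
  induction n with
  | zero => simpa using const 1
  | succ n ih => simpa only [pow_succ] using ih.mul hf

lemma sum {ι : Type*} (s : Finset ι) {F : ι → ℂ → ℂ} (h : ∀ i ∈ s, IsRational (F i)) :
    IsRational fun t => ∑ i ∈ s, F i t := by
  classical
  induction s using Finset.induction_on with
  | empty => simpa using const 0
  | insert i s hi ih =>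
    simp only [Finset.sum_insert hi]
    exact (h i (by simp)).add (ih fun j hj => h j (by simp [hj]))

lemma inv_sub (c : ℂ) : IsRational fun t => (t - c)⁻¹ := by
  refine ⟨1, Polynomial.X - Polynomial.C c, Polynomial.X_sub_C_ne_zero c, ?_⟩
  filter_upwards [eventually_eval_ne_zero (Polynomial.X_sub_C_ne_zero c)] with t ht
  simp only [Polynomial.eval_sub, Polynomial.eval_X, Polynomial.eval_C] at ht
  simp [ht]

lemma toFun (r : RatFunc ℂ) : IsRational (toFun r) := by
  refine ⟨r.num, r.denom, r.denom_ne_zero, ?_⟩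
  filter_upwards [eventually_eval_ne_zero r.denom_ne_zero] with t ht
  rw [toFun_eq, mul_div_cancel₀ _ ht]

end IsRational

lemma expansion_mul_denominator {f : ℂ → ℂ} {N D : Polynomial ℂ}
    (h : ∀ᶠ t in cofinite, D.eval t * f t = N.eval t) {c : ℂ} {a : LaurentSeries ℂ}
    (ha : Expansion f c a) :
    ∃ d, VanishesBelow 0 d ∧ d.coeff 0 = D.eval c ∧ VanishesBelow 0 (d * a) ∧
      (d * a).coeff 0 = N.eval c := by
  obtain ⟨n, hn, hn', hn0⟩ := expansion_polynomial N c
  obtain ⟨d, hd, hd', hd0⟩ := expansion_polynomial D c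
  refine ⟨d, hd', hd0, ?_⟩
  rw [(hd.mul ha).unique hn (h.filter_mono (nhdsNE_le_cofinite c))]
  exact ⟨hn', hn0⟩

/-- A rational function that is regular at every nonzero point is a Laurent polynomial. -/
lemma exists_pow_mul_eq_polynomial {f : ℂ → ℂ} (hf : IsRational f)
    (hreg : ∀ c ≠ 0, ∃ a, Expansion f c a ∧ VanishesBelow 0 a) :
    ∃ (m : ℕ) (N : Polynomial ℂ), ∀ᶠ t in cofinite, t ^ m * f t = N.eval t := by
  obtain ⟨N, D, hD, h⟩ := hf
  induction hn : D.natDegree generalizing f N D with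
  | zero =>
    obtain ⟨k, rfl⟩ := Polynomial.natDegree_eq_zero.mp hn
    have hk : k ≠ 0 := by simpa using hD
    refine ⟨0, Polynomial.C k⁻¹ * N, ?_⟩
    filter_upwards [h] with t ht
    simp only [Polynomial.eval_mul, Polynomial.eval_C] at ht ⊢
    rw [← ht, inv_mul_cancel_left₀ hk, pow_zero, one_mul]
  | succ n ih =>
    -- A root at 0 is moved into the power of `t`. At a root `c ≠ 0` regularity of `f` makes `N`
    -- vanish as well, and the factor cancels.
    obtain ⟨c, hc⟩ := IsAlgClosed.exists_root D (by
      intro h0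
      rw [Polynomial.natDegree_eq_of_degree_eq_some h0] at hn
      exact Nat.succ_ne_zero n hn.symm)
    obtain ⟨E, rfl⟩ := Polynomial.dvd_iff_isRoot.mpr hc
    have hE : E ≠ 0 := right_ne_zero_of_mul hD
    have hEn : E.natDegree = n := by
      rw [Polynomial.natDegree_mul (Polynomial.X_sub_C_ne_zero c) hE,
        Polynomial.natDegree_X_sub_C] at hn
      lia
    have hne : ∀ᶠ t in cofinite, t - c ≠ 0 := by
      simpa using eventually_eval_ne_zero (Polynomial.X_sub_C_ne_zero c)
    rcases eq_or_ne c 0 with rfl | hc0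
    · have hreg' : ∀ c ≠ 0, ∃ a, Expansion (fun t => t * f t) c a ∧ VanishesBelow 0 a := by
        intro c hc
        obtain ⟨a, ha, ha'⟩ := hreg c hc
        exact ⟨_, (expansion_id c).mul ha, ha'.lin_mul c⟩
      have h' : ∀ᶠ t in cofinite, E.eval t * (t * f t) = N.eval t := by
        filter_upwards [h] with t ht
        rw [← ht, Polynomial.eval_mul]
        simp
        ring
      obtain ⟨m, M, hM⟩ := ih hreg' N E hE h' hEn
      refine ⟨m + 1, M, ?_⟩
      filter_upwards [hM] with t ht
      rw [← ht]; ring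
    · obtain ⟨a, ha, ha'⟩ := hreg c hc0
      obtain ⟨d, hd, hd0, -, h0⟩ := expansion_mul_denominator h ha
      rw [hd.coeff_mul_lead ha' (j := 0) rfl, hd0, hc.eq_zero, zero_mul] at h0
      obtain ⟨M, rfl⟩ := Polynomial.dvd_iff_isRoot.mpr (show N.IsRoot c from h0.symm)
      refine ih hreg M E hE ?_ hEn
      filter_upwards [h, hne] with t ht htc
      simp only [Polynomial.eval_mul, Polynomial.eval_sub, Polynomial.eval_X,
        Polynomial.eval_C] at ht
      apply mul_left_cancel₀ htc
      rw [← ht, mul_assoc]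

lemma expansion_zpow (k : ℤ) : Expansion (fun z => z ^ k) 0 (HahnSeries.single k 1) := by
  rcases k with n | n
  · have := (expansion_sub_center 0).pow n
    simpa [HahnSeries.single_pow] using this
  · have := expansion_inv.pow (n + 1)
    rw [HahnSeries.single_pow] at this
    refine (by simpa [Int.negSucc_eq] using this : Expansion _ 0 _).congr ?_
    filter_upwards with z
    simp [zpow_negSucc]

/-- The constant terms of a Laurent polynomial at the origin and at infinity agree. -/
lemma coeff_zero_eq_of_laurentPolynomial {f : ℂ → ℂ} {m : ℕ} {N : Polynomial ℂ}
    (h : ∀ᶠ t in cofinite, t ^ m * f t = N.eval t) {a b : LaurentSeries ℂ}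
    (ha : Expansion f 0 a) (hb : Expansion (fun w => f w⁻¹) 0 b) : a.coeff 0 = b.coeff 0 := by
  have hf : ∀ᶠ t in cofinite, f t =
      ∑ i ∈ Finset.range (N.natDegree + 1), N.coeff i * t ^ ((i : ℤ) - m) := by
    filter_upwards [h, (Set.finite_singleton (0 : ℂ)).compl_mem_cofinite] with t ht ht0
    have ht0 : t ≠ 0 := ht0
    apply mul_left_cancel₀ (pow_ne_zero m ht0)
    rw [ht, Polynomial.eval_eq_sum_range, Finset.mul_sum]
    refine Finset.sum_congr rfl fun i _ => ?_
    rw [zpow_sub₀ ht0, zpow_natCast, zpow_natCast]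
    field_simp
  have hinv : Tendsto (fun w : ℂ => w⁻¹) (𝓝[≠] 0) cofinite :=
    inv_injective.tendsto_cofinite.mono_left (nhdsNE_le_cofinite 0)
  rw [ha.unique (Expansion.sum _ fun (i : ℕ) _ => (expansion_zpow ((i : ℤ) - m)).const_mul (N.coeff i))
      (hf.filter_mono (nhdsNE_le_cofinite 0)),
    hb.unique (Expansion.sum _ fun (i : ℕ) _ => (expansion_zpow (m - (i : ℤ))).const_mul (N.coeff i))
      ?_]
  · rw [HahnSeries.coeff_sum, HahnSeries.coeff_sum]
    refine Finset.sum_congr rfl fun i _ => ?_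
    rw [coeff_C_mul, coeff_C_mul]
    rcases eq_or_ne (i : ℤ) m with h | h
    · simp [h]
    · rw [HahnSeries.coeff_single_of_ne (by lia), HahnSeries.coeff_single_of_ne (by lia)]
  · filter_upwards [hinv.eventually hf] with w hw
    rw [hw]
    refine Finset.sum_congr rfl fun i _ => ?_
    rw [inv_zpow', neg_sub]

/-! ### Partial fractions and the sum of residues -/

lemma expansion_inv_sub (c : ℂ) :
    Expansion (fun t => (t - c)⁻¹) c (HahnSeries.single (-1) 1) := by
  refine ⟨1, fun _ => 1, by fun_prop, ?_, ?_⟩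
  · filter_upwards [self_mem_nhdsWithin] with z hz
    simp [sub_ne_zero.mpr (show z ≠ c from hz)]
  · rw [HahnSeries.single_mul_single, taylor_const]; simp

lemma expansion_inv_sub_of_ne {c z : ℂ} (h : z ≠ c) :
    ∃ a, Expansion (fun t => (t - c)⁻¹) z a ∧ VanishesBelow 0 a ∧ a.coeff 0 = (z - c)⁻¹ := by
  refine ⟨_, Expansion.of_analyticAt (f := fun t => (t - c)⁻¹) (c := z) ?_,
    vanishesBelow_ofPowerSeries _, ?_⟩
  · exact AnalyticAt.fun_inv (by fun_prop) (sub_ne_zero.mpr h)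
  · simpa [taylor] using LaurentSeries.coeff_coe_powerSeries (taylor (fun t => (t - c)⁻¹) z) 0

lemma expansion_inv_sub_infinity (c : ℂ) :
    ∃ a, Expansion (fun w => (w⁻¹ - c)⁻¹) 0 a ∧ a.coeff 0 = 0 := by
  have ha : AnalyticAt ℂ (fun w => w * (1 - c * w)⁻¹) 0 :=
    analyticAt_id.fun_mul (AnalyticAt.fun_inv (by fun_prop) (by simp))
  refine ⟨_, (Expansion.of_analyticAt ha).congr ?_, ?_⟩
  · filter_upwards [self_mem_nhdsWithin] with w hw
    have hw : w ≠ 0 := hw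
    rw [show w⁻¹ - c = (1 - c * w) * w⁻¹ by field_simp, mul_inv, inv_inv, mul_comm]
  · simpa [taylor] using
      LaurentSeries.coeff_coe_powerSeries (taylor (fun w => w * (1 - c * w)⁻¹) 0) 0

/-- A rational function with simple poles off the origin: the difference of the constant terms at
infinity and at the origin is the sum of the residues of `f(t) / t`. -/
lemma exists_int_of_residues {f : ℂ → ℂ} (hf : IsRational f)
    (hres : ∀ c ≠ 0, ∃ a, Expansion f c a ∧ VanishesBelow (-1) a ∧
      ∃ n : ℤ, a.coeff (-1) = n * (c / 4))
    {a b : LaurentSeries ℂ} (ha : Expansion f 0 a) (hb : Expansion (fun w => f w⁻¹) 0 b) :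
    ∃ n : ℤ, 4 * (b.coeff 0 - a.coeff 0) = n := by
  classical
  choose! A hA hA' n hn using hres
  obtain ⟨N, D, hD, hND⟩ := id hf
  set s := D.roots.toFinset.erase 0 with hs
  have hs0 : ∀ c ∈ s, c ≠ 0 := fun c hc => Finset.ne_of_mem_erase hc
  -- The principal parts off the origin. At a nonzero point outside `s`, `D` does not vanish and `f`
  -- is regular, so `f - R` is regular at every nonzero point.
  set R : ℂ → ℂ := fun t => ∑ c ∈ s, n c * (c / 4) * (t - c)⁻¹ with hR
  have hRrat : IsRational R :=
    IsRational.sum s fun c _ => (IsRational.const _).mul (IsRational.inv_sub c)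
  obtain ⟨m, M, hM⟩ := exists_pow_mul_eq_polynomial (hf.sub hRrat) (by
    intro z hz
    have hterm : ∀ c, ∃ e, Expansion (fun t => (t - c)⁻¹) z e ∧ VanishesBelow (-1) e ∧
        e.coeff (-1) = if c = z then 1 else 0 := by
      intro c
      rcases eq_or_ne c z with rfl | hcz
      · refine ⟨_, expansion_inv_sub c, fun i hi => ?_, by simp⟩
        rw [HahnSeries.coeff_single_of_ne (by lia)]
      · obtain ⟨e, he, he', -⟩ := expansion_inv_sub_of_ne hcz.symm
        exact ⟨e, he, he'.mono (by lia), by rw [he' (-1) (by lia), if_neg hcz]⟩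
    choose e he he' he0 using hterm
    refine ⟨_, (hA z hz).sub (Expansion.sum s fun c _ => (he c).const_mul (n c * (c / 4))), ?_⟩
    have hsum : VanishesBelow (-1) (∑ c ∈ s, HahnSeries.C (n c * (c / 4)) * e c) := by
      intro i hi
      rw [HahnSeries.coeff_sum]
      exact Finset.sum_eq_zero fun c _ => by rw [coeff_C_mul, he' c i hi, mul_zero]
    refine ((hA' z hz).sub hsum).succ ?_
    rw [HahnSeries.coeff_sub, HahnSeries.coeff_sum]
    simp only [coeff_C_mul, he0, mul_ite, mul_one, mul_zero]
    rw [Finset.sum_ite_eq']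
    split_ifs with hzs
    · rw [hn z hz, sub_self]
    · have hDz : D.eval z ≠ 0 := by
        intro h0
        exact hzs (by simp [hs, hz, hD, h0])
      obtain ⟨d, hd, hd0, hda, -⟩ := expansion_mul_denominator hND (hA z hz)
      have := hda.of_mul hd (by rwa [hd0])
      rw [this (-1) (by lia), sub_zero])
  have h0 : ∀ c ∈ s, ∃ e, Expansion (fun t => (t - c)⁻¹) 0 e ∧ e.coeff 0 = -c⁻¹ := by
    intro c hc
    obtain ⟨e, he, -, he0⟩ := expansion_inv_sub_of_ne (hs0 c hc).symm
    exact ⟨e, he, by rw [he0, zero_sub, inv_neg]⟩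
  choose! e he he0 using h0
  choose e' he' he0' using expansion_inv_sub_infinity
  have key := coeff_zero_eq_of_laurentPolynomial hM
    (ha.sub (Expansion.sum s fun c hc => (he c hc).const_mul (n c * (c / 4))))
    (hb.sub (Expansion.sum s fun c _ => (he' c).const_mul (n c * (c / 4))))
  simp only [HahnSeries.coeff_sub, HahnSeries.coeff_sum, coeff_C_mul, he0', mul_zero,
    Finset.sum_const_zero, sub_zero] at key
  refine ⟨∑ c ∈ s, n c, ?_⟩
  rw [← key, sub_sub_cancel_left, ← Finset.sum_neg_distrib, Finset.mul_sum, Int.cast_sum]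
  refine Finset.sum_congr rfl fun c hc => ?_
  rw [he0 c hc]
  have := hs0 c hc
  field_simp

/-! ### Rational solutions -/

/-- A rational function is holomorphic at the origin if and only if its Laurent series is regular,
and then its value is the constant term. -/
lemma holomorphicAtZero_iff {r : RatFunc ℂ} {a : LaurentSeries ℂ} (ha : Expansion (toFun r) 0 a) :
    HolomorphicAtZero r ↔ VanishesBelow 0 a := by
  have h : ∀ᶠ t in cofinite, r.denom.eval t * toFun r t = r.num.eval t := by
    filter_upwards [eventually_eval_ne_zero r.denom_ne_zero] with t ht
    rw [toFun_eq, mul_div_cancel₀ _ ht]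
  obtain ⟨d, hd, hd0, hda, hda0⟩ := expansion_mul_denominator h ha
  constructor
  · intro hr
    simpa using hda.of_mul hd (by rwa [hd0])
  -- A regular series over a vanishing denominator would make the numerator vanish too, against
  -- coprimality.
  · intro ha' hr
    rw [hd.coeff_mul_lead ha' (j := 0) rfl, hd0, hr, zero_mul] at hda0
    obtain ⟨x, y, hxy⟩ := r.isCoprime_num_denom
    have := congrArg (Polynomial.eval 0) hxy
    simp [hr, ← hda0] at this

lemma coeff_zero_eq_toFun {r : RatFunc ℂ} {a : LaurentSeries ℂ} (ha : Expansion (toFun r) 0 a)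
    (hr : HolomorphicAtZero r) : a.coeff 0 = toFun r 0 := by
  have h : ∀ᶠ t in cofinite, r.denom.eval t * toFun r t = r.num.eval t := by
    filter_upwards [eventually_eval_ne_zero r.denom_ne_zero] with t ht
    rw [toFun_eq, mul_div_cancel₀ _ ht]
  obtain ⟨d, hd, hd0, -, hda0⟩ := expansion_mul_denominator h ha
  rw [hd.coeff_mul_lead ((holomorphicAtZero_iff ha).mp hr) (j := 0) rfl, hd0] at hda0
  rw [toFun_eq, eq_div_iff hr, mul_comm, hda0]

variable {α₀ α₁ α₃ : ℂ} {q₁ p₁ q₂ p₂ : RatFunc ℂ}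

lemma isRational_hamiltonian :
    IsRational (hamiltonian α₀ α₁ α₃ (toFun q₁) (toFun p₁) (toFun q₂) (toFun p₂)) := by
  have h₁ := IsRational.toFun q₁
  have h₂ := IsRational.toFun p₁
  have h₃ := IsRational.toFun q₂
  have h₄ := IsRational.toFun p₂
  exact ((((((((((((h₁.pow 2).mul (h₂.pow 2)).sub ((h₁.pow 2).mul h₂)).add
    (((IsRational.const _).mul h₁).mul h₂)).sub ((IsRational.const _).mul h₁)).sub
    (IsRational.id.mul h₂)).add ((h₃.pow 2).mul (h₄.pow 2))).sub ((h₃.pow 2).mul h₄)).add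
    (((IsRational.const _).mul h₃).mul h₄)).sub ((IsRational.const _).mul h₃)).sub
    (IsRational.id.mul h₄)).add
    ((((IsRational.const _).mul IsRational.id).mul h₂).mul h₄)).add
    (((((IsRational.const _).mul h₁).mul h₂).mul h₃).mul h₄)

namespace IsRationalSolution

lemma isMeromorphicSolutionAt (h : IsRationalSolution α₀ α₁ α₃ q₁ p₁ q₂ p₂) (c : ℂ) :
    IsMeromorphicSolutionAt α₀ α₁ α₃ (toFun q₁) (toFun p₁) (toFun q₂) (toFun p₂) c :=
  ⟨meromorphicAt_toFun q₁ c, meromorphicAt_toFun p₁ c, meromorphicAt_toFun q₂ c,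
    meromorphicAt_toFun p₂ c, h.filter_mono (nhdsNE_le_cofinite c)⟩

lemma exists_expansion_zero (h : IsRationalSolution α₀ α₁ α₃ q₁ p₁ q₂ p₂) :
    ∃ v, Expansion (hamiltonian α₀ α₁ α₃ (toFun q₁) (toFun p₁) (toFun q₂) (toFun p₂)) 0 v ∧
      IsHZero α₀ α₁ α₃ q₁ p₁ q₂ p₂ (v.coeff 0) := by
  obtain ⟨hq₁, hp₁, hq₂, hp₂, hs⟩ := h.isMeromorphicSolutionAt 0
  obtain ⟨a₁, hq₁⟩ := exists_expansion hq₁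
  obtain ⟨b₁, hp₁⟩ := exists_expansion hp₁
  obtain ⟨a₂, hq₂⟩ := exists_expansion hq₂
  obtain ⟨b₂, hp₂⟩ := exists_expansion hp₂
  have hsol : FormalSolution (lin 0) (lin 0) (α₀ + α₁ + α₃) α₀ α₁ a₁ b₁ a₂ b₂ _ :=
    formalSolution_of_eventually (expansion_id 0) (expansion_id 0) hq₁ hp₁ hq₂ hp₂ hs
  refine ⟨_, expansion_hamiltonian hq₁ hp₁ hq₂ hp₂, ?_⟩
  simp only [IsHZero, holomorphicAtZero_iff hq₁, holomorphicAtZero_iff hp₁,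
    holomorphicAtZero_iff hq₂, holomorphicAtZero_iff hp₂]
  by_cases h₁ : VanishesBelow 0 b₁
  · by_cases h₂ : VanishesBelow 0 b₂
    · have h₃ := hsol.regular_q₁_zero h₁ h₂
      have h₄ := hsol.swap.regular_q₁_zero h₂ h₁
      exact Or.inl ⟨h₃, h₁, h₄, h₂, hsol.regular_zero h₁ h₂
        (coeff_zero_eq_toFun hq₁ ((holomorphicAtZero_iff hq₁).mpr h₃))
        (coeff_zero_eq_toFun hp₁ ((holomorphicAtZero_iff hp₁).mpr h₁))
        (coeff_zero_eq_toFun hq₂ ((holomorphicAtZero_iff hq₂).mpr h₄))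
        (coeff_zero_eq_toFun hp₂ ((holomorphicAtZero_iff hp₂).mpr h₂)) rfl⟩
    · obtain ⟨h₃, h₄, h₅, h₆⟩ := hsol.swap.pole_zero h₂
      rw [formalEnergy_swap] at h₆
      exact Or.inr (Or.inr ⟨h₄, h₅, h₃, h₂, h₆⟩)
  · obtain ⟨h₃, h₄, h₅, h₆⟩ := hsol.pole_zero h₁
    exact Or.inr (Or.inl ⟨h₃, h₁, h₄, h₅, h₆⟩)

lemma exists_expansion_infinity (h : IsRationalSolution α₀ α₁ α₃ q₁ p₁ q₂ p₂) :
    ∃ u, Expansion (fun w =>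
        hamiltonian α₀ α₁ α₃ (toFun q₁) (toFun p₁) (toFun q₂) (toFun p₂) w⁻¹) 0 u ∧
      u.coeff 0 = hInfinity α₀ α₁ α₃ := by
  obtain ⟨a₁, hq₁⟩ := exists_expansion (meromorphicAt_toFun_inv q₁)
  obtain ⟨b₁, hp₁⟩ := exists_expansion (meromorphicAt_toFun_inv p₁)
  obtain ⟨a₂, hq₂⟩ := exists_expansion (meromorphicAt_toFun_inv q₂)
  obtain ⟨b₂, hp₂⟩ := exists_expansion (meromorphicAt_toFun_inv p₂)
  have hinv : Tendsto (fun w : ℂ => w⁻¹) (𝓝[≠] 0) cofinite :=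
    inv_injective.tendsto_cofinite.mono_left (nhdsNE_le_cofinite 0)
  have hσ : Expansion (fun w => -w) 0 eulerInf := by
    have h1 := (expansion_sub_center 0).neg
    rw [show -HahnSeries.single 1 1 = eulerInf by rw [eulerInf, HahnSeries.single_neg]] at h1
    simpa using h1
  -- For `w = 1/t` the derivation `t d/dt` is `-w d/dw`.
  have hderiv : ∀ {r : RatFunc ℂ} {a : LaurentSeries ℂ}, Expansion (fun w => toFun r w⁻¹) 0 a →
      ∀ᶠ w in 𝓝[≠] (0 : ℂ),
        -w * deriv (fun w => toFun r w⁻¹) w = w⁻¹ * deriv (toFun r) w⁻¹ := by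
    intro r a hr
    filter_upwards [hr.eventually_differentiableAt, self_mem_nhdsWithin] with w hw hw0
    have hw0 : w ≠ 0 := hw0
    have hd : DifferentiableAt ℂ (toFun r) w⁻¹ := by
      have h1 : DifferentiableAt ℂ (fun w => toFun r w⁻¹) (w⁻¹)⁻¹ := by rwa [inv_inv]
      have := h1.comp w⁻¹ (differentiableAt_inv (inv_ne_zero hw0))
      simpa [Function.comp_def] using this
    have h1 : HasDerivAt (fun w => toFun r w⁻¹) _ w :=
      hd.hasDerivAt.comp w (hasDerivAt_inv hw0)
    rw [h1.deriv]
    field_simp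
  have hsol : FormalSolution eulerInf linInf (α₀ + α₁ + α₃) α₀ α₁ a₁ b₁ a₂ b₂
      (a₁ * b₁ + a₂ * b₂) := by
    refine formalSolution_of_eventually hσ expansion_inv hq₁ hp₁ hq₂ hp₂ ?_
    filter_upwards [hinv.eventually h, hderiv hq₁, hderiv hp₁, hderiv hq₂, hderiv hp₂]
      with w hw h₁ h₂ h₃ h₄
    rw [h₁, h₂, h₃, h₄]
    exact hw
  exact ⟨_, expansion_energy expansion_inv hq₁ hp₁ hq₂ hp₂, hsol.energy_infinity⟩

end IsRationalSolution

end SasanoA52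

theorem mainTheorem9 (α₀ α₁ α₂ α₃ : ℂ) (hα : α₀ + α₁ + 2 * α₂ + α₃ = 1 / 2) :
    -- residues of the Hamiltonian along meromorphic solutions at a nonzero point
    (∀ c : ℂ, c ≠ 0 → ∀ q₁ p₁ q₂ p₂ : ℂ → ℂ,
      SasanoA52.IsMeromorphicSolutionAt α₀ α₁ α₃ q₁ p₁ q₂ p₂ c →
      ∃ a : LaurentSeries ℂ,
        SasanoA52.HasLaurentExpansionAt (SasanoA52.hamiltonian α₀ α₁ α₃ q₁ p₁ q₂ p₂) c a ∧
        ∃ n : ℤ, a.coeff (-1) = n * (c / 4)) ∧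
    -- constant terms of the Hamiltonian along rational solutions
    (∀ q₁ p₁ q₂ p₂ : RatFunc ℂ,
      SasanoA52.IsRationalSolution α₀ α₁ α₃ q₁ p₁ q₂ p₂ →
      ∃ u v : LaurentSeries ℂ,
        SasanoA52.HasLaurentExpansionAtInfinity
          (SasanoA52.hamiltonian α₀ α₁ α₃ (SasanoA52.toFun q₁) (SasanoA52.toFun p₁)
            (SasanoA52.toFun q₂) (SasanoA52.toFun p₂)) u ∧
        SasanoA52.HasLaurentExpansionAt
          (SasanoA52.hamiltonian α₀ α₁ α₃ (SasanoA52.toFun q₁) (SasanoA52.toFun p₁)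
            (SasanoA52.toFun q₂) (SasanoA52.toFun p₂)) 0 v ∧
        u.coeff 0 = SasanoA52.hInfinity α₀ α₁ α₃ ∧
        SasanoA52.IsHZero α₀ α₁ α₃ q₁ p₁ q₂ p₂ (v.coeff 0) ∧
        ∃ n : ℤ, 4 * (u.coeff 0 - v.coeff 0) = n) := by
  refine ⟨fun c hc q₁ p₁ q₂ p₂ h => ?_, fun q₁ p₁ q₂ p₂ h => ?_⟩
  · obtain ⟨a, ha, -, hn⟩ := SasanoA52.exists_expansion_hamiltonian hc h
    exact ⟨a, ha.hasLaurentExpansionAt, hn⟩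
  · obtain ⟨u, hu, hu0⟩ := h.exists_expansion_infinity
    obtain ⟨v, hv, hv0⟩ := h.exists_expansion_zero
    exact ⟨u, v, hu.hasLaurentExpansionAt, hv.hasLaurentExpansionAt, hu0, hv0,
      SasanoA52.exists_int_of_residues SasanoA52.isRational_hamiltonian
        (fun c hc => SasanoA52.exists_expansion_hamiltonian hc (h.isMeromorphicSolutionAt c))
        hv hu⟩
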